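/- **Conventions.** Let $\mathbb F_q$ be the finite field of order $q$. For $C\subseteq\mathbb F_q^n$ a linear code, $C^\perp$ is its dual for the standard bilinear form, and $|c|$ is the Hamming weight of a vector $c$. For $E\subseteq\mathbb F_q$ and a set $A$ of non-negative integers, $\operatorname{ev}_E(\mathbb F_q[X]^{A})\subseteq\mathbb F_q^E$ is the space of evaluations on $E$ of the polynomials all of whose monomials have exponent in $A$; $\mathrm{RS}_E(q,k)=\operatorname{ev}_E(\mathbb F_q[X]^{[0,k)})$. For $E=\mathbb F_q$ the subscript is omitted. For $C_1\subseteq\mathbb F_q^{n_1}$, $C_2\subseteq\mathbb F_q^{n_2}$, the tensor code $C_1\otimes C_2$ is the space of $n_1\times n_2$ matrices with all columns in $C_1$ and all rows in $C_2$. A *subsystem code* of length $n$ over $\mathbb F_q$ is a pair $Q=(Q_X,Q_Z)$ of subspaces of $\mathbb F_q^n$; it is a *CSS code* if $Q_X^\perp\subseteq Q_Z$. It is an $[[n,k,d]]_q$ subsystem code if $k=\dim(Q_Z+Q_X^\perp)-\dim(Q_X^\perp)$ (the *dimension* of $Q$) and its distance is at least $d$, i.e. $|c|\ge d$ for every $c\in((Q_X+Q_Z^\perp)\setminus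 Q_Z^\perp)\cup((Q_Z+Q_X^\perp)\setminus Q_X^\perp)$. It has locality $w$ if $Q_X=\ker H_X$ and $Q_Z=\ker H_Z$ for matrices $H_X,H_Z$ all of whose rows and columns have at most $w$ nonzero entries. The subsystem product of two CSS codes is $Q^1\otimes Q^2=(Q^1_X\otimes Q^2_X,\;Q^1_Z\otimes Q^2_Z)$. A *quantum Reed–Solomon code* on $E\subseteq\mathbb F_q$ is a CSS code such that $Q_X,Q_X^\perp,Q_Z,Q_Z^\perp$ are all of the form $\mathrm{RS}_E(q,k)$ (with possibly different $k\ge 0$). Put $S=Q_Z\cap Q_X^\perp$ and let $\operatorname{Enc}:\mathbb F_q^\ell\to Q_Z/S$ be injective. We say that $(Q,\operatorname{Enc})$ *supports a transversal $C^{r-1}Z$ gate on $\ell$ logical qudits with coefficients vector $a\in\mathbb F_q^n$* if for all $z^1,\dots,z^r\in\mathbb F_q^\ell$ and all $y^h\in\operatorname{Enc}(z^h)$, $h=1,\dots,r$, $$\sum_{j=1}^{\ell} z^1_j\cdots z^r_j=\sum_{j=1}^{n}a_j\,y^1_j\cdots y^r_j ,$$ and that it *supports a transversal $U^r$ gate*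 with coefficients vector $a$ if $\sum_j z_j^r=\sum_j a_j y_j^r$ for all $z\in\mathbb F_q^\ell$ and $y\in\operatorname{Enc}(z)$. **Theorem.** (1) For every $\epsilon>0$ there exists $\Delta=\Delta(\epsilon)>0$ such that the following holds. Let $\mathbb F_q$ be a finite field, let $E_1,E_2\subseteq\mathbb F_q$ have the same size $n$, and for $i\in\{1,2\}$ let $Q^i$ be a quantum Reed–Solomon code on $E_i$, of dimension $k_i$, such that $$\dim Q^1_X\le(1-\epsilon)n,\quad \dim Q^1_Z\le(1-\epsilon)n,\quad \dim (Q^1_Z)^\perp+\dim Q^2_X\le(1-\epsilon)n,\quad \dim (Q^1_X)^\perp+\dim Q^2_Z\le(1-\epsilon)n .$$ Then $Q^1\otimes Q^2$ is an $[[n^2,\;k_1k_2,\;\Delta n^2]]_q$ subsystem code of locality $2n$. (2) For every integer $r\ge2$ there exist $\Delta=\Delta(r)>0$ and $c=c(r)>0$ such that the following holds. Let $\epsilon=1/(4r)$, let $\mathbb F_q$ be a finite field with $q\ge4r^2$, and let $Q^i=(\mathrm{RS}(q,k^i_X),\mathrm{RS}(q,k^i_Z))$ for $i\in\{1,2\}$,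 with $$k^1_X=k^1_Z=q-\lfloor\epsilon q\rfloor,\qquad k^2_X=q-2\lfloor\epsilon q\rfloor,\qquad k^2_Z=\lfloor q/r\rfloor .$$ Then $Q^1,Q^2$ are CSS codes, and $Q=Q^1\otimes Q^2$ is a $$[[\,q^2,\;(k^1_X+k^1_Z-q)(k^2_X+k^2_Z-q),\;\Delta q^2\,]]_q$$ subsystem code of locality $2q$, whose dimension lies between $c\,q^2$ and $q^2$. Furthermore let $\underline\ell=\lceil q/r-q/(2r^2)\rceil$ and $\overline\ell=\lfloor q/r\rfloor$, let $L_1=L_2=\operatorname{ev}(\mathbb F_q[X]^{[\underline\ell,\overline\ell)})$, $L=L_1\otimes L_2$ and $S=Q_Z\cap Q_X^\perp$. Then $\underline\ell<\overline\ell$, $L_i\subseteq Q^i_Z$, $\dim L=(\overline\ell-\underline\ell)^2$, and there exist a linear isomorphism $\operatorname{Enc}:\mathbb F_q^{\dim L}\to(L+S)/S$ and a vector $a\in\mathbb F_q^{q^2}$ such that $(Q,\operatorname{Enc})$ supports both a transversal $C^{r-1}Z$ gate and a transversal $U^r$ gate on $(\overline\ell-\underline\ell)^2$ logical qudits, with coefficients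 vector $a$. -/

import Mathlib

open Polynomial Module
open scoped ENNReal

universe u

noncomputable section

namespace SubsysRS

variable {F : Type*} [Field F] {ι κ : Type*}

/-- The Hamming weight: the number of nonzero coordinates. -/
def weight [Fintype ι] (x : ι → F) : ℕ :=
  open Classical in hammingNorm x

/-- The dual code `C^⊥`, with respect to the standard bilinear form `x ⬝ᵥ y = ∑ i, x i * y i`. -/
def dual [Fintype ι] (C : Submodule F (ι → F)) : Submodule F (ι → F) where
  carrier := {x | ∀ y ∈ C, x ⬝ᵥ y = 0}
  add_mem' := by
    intro a b ha hb y hy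
    rw [add_dotProduct, ha y hy, hb y hy, add_zero]
  zero_mem' := by
    intro y _
    exact zero_dotProduct y
  smul_mem' := by
    intro c x hx y hy
    rw [smul_dotProduct, hx y hy, smul_zero]

/-- The tensor code `C₁ ⊗ C₂`: all matrices (indexed by pairs) each of whose columns lies in `C₁`
and each of whose rows lies in `C₂`. -/
def tensor (C₁ : Submodule F (ι → F)) (C₂ : Submodule F (κ → F)) :
    Submodule F (ι × κ → F) where
  carrier := {c | (∀ j, (fun i => c (i, j)) ∈ C₁) ∧ (∀ i, (fun j => c (i, j)) ∈ C₂)}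
  add_mem' := by
    intro a b ha hb
    exact ⟨fun j => C₁.add_mem (ha.1 j) (hb.1 j), fun i => C₂.add_mem (ha.2 i) (hb.2 i)⟩
  zero_mem' := ⟨fun _ => C₁.zero_mem, fun _ => C₂.zero_mem⟩
  smul_mem' := by
    intro c x hx
    exact ⟨fun j => C₁.smul_mem c (hx.1 j), fun i => C₂.smul_mem c (hx.2 i)⟩

/-- `F[X]^A`: polynomials all of whose monomials have their exponent in `A`. -/
def polysOn (F : Type*) [Field F] (A : Set ℕ) : Submodule F F[X] where
  carrier := {f | ∀ n, n ∉ A → f.coeff n = 0}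
  add_mem' := by
    intro f g hf hg n hn
    rw [coeff_add, hf n hn, hg n hn, add_zero]
  zero_mem' := by
    intro n _
    exact coeff_zero n
  smul_mem' := by
    intro c f hf n hn
    rw [coeff_smul, hf n hn, smul_zero]

/-- Evaluation of polynomials at the points `α i`. -/
def evalAt (α : ι → F) : F[X] →ₗ[F] (ι → F) :=
  LinearMap.pi fun i => Polynomial.leval (α i)

/-- The evaluation code `ev(F[X]^A)` at the points `α i`. -/
def evCode (α : ι → F) (A : Set ℕ) : Submodule F (ι → F) :=
  (polysOn F A).map (evalAt α)

/-- The Reed-Solomon code: evaluations, at the points `α i`, of the polynomials of degree `< k`. -/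
def RS (α : ι → F) (k : ℕ) : Submodule F (ι → F) :=
  evCode α (Set.Ico 0 k)

/-- A quantum subsystem CSS code with coordinates indexed by `ι`: any pair of classical codes. -/
structure SubsystemCode (F : Type*) [Field F] (ι : Type*) where
  X : Submodule F (ι → F)
  Z : Submodule F (ι → F)

namespace SubsystemCode

/-- The orthogonality condition making the pair a (non-subsystem) quantum CSS code. -/
def IsCSS [Fintype ι] (Q : SubsystemCode F ι) : Prop :=
  dual Q.X ≤ Q.Z

/-- `dim(Q_Z + Q_X^⊥) - dim(Q_X^⊥)`; for CSS codes this is `dim Q_Z - dim Q_X^⊥`. -/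
def dimension [Fintype ι] (Q : SubsystemCode F ι) : ℕ :=
  finrank F ↥(Q.Z ⊔ dual Q.X) - finrank F ↥(dual Q.X)

/-- The minimum weight in `((Q_X + Q_Z^⊥) \ Q_Z^⊥) ∪ ((Q_Z + Q_X^⊥) \ Q_X^⊥)`
(it is `⊤` if this set is empty, which happens only in dimension `0`). -/
def distance [Fintype ι] (Q : SubsystemCode F ι) : ℕ∞ :=
  ⨅ c ∈ (((Q.X ⊔ dual Q.Z : Submodule F (ι → F)) : Set (ι → F)) \ (dual Q.Z : Set (ι → F))) ∪
      (((Q.Z ⊔ dual Q.X : Submodule F (ι → F)) : Set (ι → F)) \ (dual Q.X : Set (ι → F))),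
    (weight c : ℕ∞)

/-- `Q` is an `[[n, k, d]]` subsystem code: length `n`, dimension `k`, distance at least `d`. -/
def HasParams [Fintype ι] (Q : SubsystemCode F ι) (n k : ℕ) (d : ℝ) : Prop :=
  Fintype.card ι = n ∧ Q.dimension = k ∧ ENNReal.ofReal d ≤ (Q.distance : ℝ≥0∞)

/-- `C` is the kernel of a matrix all of whose rows and columns have weight at most `w`. -/
def HasSparseCheck [Fintype ι] (C : Submodule F (ι → F)) (w : ℕ) : Prop :=
  ∃ (m : ℕ) (H : Matrix (Fin m) ι F), LinearMap.ker H.mulVecLin = C ∧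
    (∀ i, weight (fun j => H i j) ≤ w) ∧ (∀ j, weight (fun i => H i j) ≤ w)

/-- The subsystem code has locality (at most) `w`. -/
def HasLocality [Fintype ι] (Q : SubsystemCode F ι) (w : ℕ) : Prop :=
  HasSparseCheck Q.X w ∧ HasSparseCheck Q.Z w

/-- The subsystem product of two codes. -/
def prod (Q : SubsystemCode F ι) (R : SubsystemCode F κ) : SubsystemCode F (ι × κ) where
  X := tensor Q.X R.X
  Z := tensor Q.Z R.Z

/-- The space `S = Q_Z ∩ Q_X^⊥`. -/
def stab [Fintype ι] (Q : SubsystemCode F ι) : Submodule F (ι → F) :=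
  Q.Z ⊓ dual Q.X

/-- A quantum Reed-Solomon code with evaluation points `α i`: a CSS code for which `Q_X`, `Q_Z` and
their duals are Reed-Solomon codes with these evaluation points. -/
def IsQuantumRS [Fintype ι] (α : ι → F) (Q : SubsystemCode F ι) : Prop :=
  Q.IsCSS ∧ (∃ k, Q.X = RS α k) ∧ (∃ k, dual Q.X = RS α k) ∧
    (∃ k, Q.Z = RS α k) ∧ (∃ k, dual Q.Z = RS α k)

/-- `Enc` is an injective map from `F^ℓ` to `Q_Z / (Q_Z ∩ Q_X^⊥)` (a subspace of `F^ι ⧸ S`). -/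
def IsEncoding [Fintype ι] (Q : SubsystemCode F ι) {ℓ : ℕ}
    (Enc : (Fin ℓ → F) → (ι → F) ⧸ Q.stab) : Prop :=
  Function.Injective Enc ∧ ∀ z, Enc z ∈ Q.Z.map Q.stab.mkQ

/-- The codes `Q h` with encodings `Enc h`, for `h : Fin r`, support a transversal `C^{r-1}Z` gate
on `ℓ` logical qudits with coefficients vector `a`. -/
def SupportsTransversalCZ [Fintype ι] {r ℓ : ℕ} (Q : Fin r → SubsystemCode F ι)
    (Enc : ∀ h, (Fin ℓ → F) → (ι → F) ⧸ (Q h).stab) (a : ι → F) : Prop :=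
  (∀ h, (Q h).IsEncoding (Enc h)) ∧
    ∀ (z : Fin r → Fin ℓ → F) (z' : Fin r → ι → F),
      (∀ h, (Q h).stab.mkQ (z' h) = Enc h (z h)) →
        ∑ j, ∏ h, z h j = ∑ j, a j * ∏ h, z' h j

/-- The code `Q` with encoding `Enc` supports a transversal `U^r` gate on `ℓ` logical qudits with
coefficients vector `a`. -/
def SupportsTransversalU [Fintype ι] (r : ℕ) {ℓ : ℕ} (Q : SubsystemCode F ι)
    (Enc : (Fin ℓ → F) → (ι → F) ⧸ Q.stab) (a : ι → F) : Prop :=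
  Q.IsEncoding Enc ∧
    ∀ (z : Fin ℓ → F) (z' : ι → F), Q.stab.mkQ z' = Enc z →
      ∑ j, z j ^ r = ∑ j, a j * z' j ^ r

end SubsystemCode

end SubsysRS

end

/-! Distance. A word of `(X₁ ⊗ X₂)^⊥` is a matrix with columns in `X₁^⊥` plus one with rows in
`X₂^⊥` (`dual_tensor_le`). Since `X₂^⊥ ⊆ Z₂`, a word `c` of `Z₁ ⊗ Z₂ + (X₁ ⊗ X₂)^⊥` is a difference
`u - w`, where `u` has columns in `X₁^⊥` and `w` has rows in `Z₂`. If `c` has low weight, two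
matrices of Reed-Solomon columns and rows agree almost everywhere, and bivariate low-degree testing
(`exists_mem_tensor_of_agreement`) makes `w` equal to a word of `X₁^⊥ ⊗ Z₂` off a few rows. Those
rows are repaired using the distance of `Z₁`, which puts `c` in `(X₁ ⊗ X₂)^⊥`
(`mem_dual_tensor_of_weight_lt`).

The low-degree test follows Polishchuk and Spielman: a bivariate error locator `E` of small degree
kills the disagreements, so `E * u = E * w` extends to a polynomial `P` which `E` divides on every
axis-parallel line. `dvd_of_dvd_on_lines` then gives `E ∣ P`, and the quotient is the tensor word.

Gates. In one variable, a product of `r` words of `ev(F[X]^[lo, hi))` is `X^(r * lo) * g` with total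
degree below `q`. A weight vector exists that annihilates degrees below `r * lo` and sends such a
product to the sum of `g` over a set `T` of `hi - lo` nonzero points (`exists_weights_shift`).
Replacing a factor by a word of the much smaller `X^⊥` lowers the degree below `r * lo`, so
stabilizers are invisible (`sum_prod_add_eq`). In two variables the weights are multiplied, and the
two kinds of stabilizer are removed along rows and then along columns (`exists_transversal_gates`).
The logical coordinates are the rescaled values on `T × T`; the gate identity itself forces `L ∩ S =
0` (`disjoint_stab`). -/

noncomputable section

namespace SubsysRS

/-! ### Duals and tensor products of linear codes. -/

section Codes

variable {F : Type*} [Field F] {ι κ : Type*}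

theorem mem_dual [Fintype ι] {C : Submodule F (ι → F)} {x : ι → F} :
    x ∈ dual C ↔ ∀ y ∈ C, x ⬝ᵥ y = 0 := Iff.rfl

theorem mem_tensor {C₁ : Submodule F (ι → F)} {C₂ : Submodule F (κ → F)} {c : ι × κ → F} :
    c ∈ tensor C₁ C₂ ↔ (∀ j, (fun i => c (i, j)) ∈ C₁) ∧ (∀ i, (fun j => c (i, j)) ∈ C₂) :=
  Iff.rfl

theorem tensor_mono {C₁ D₁ : Submodule F (ι → F)} {C₂ D₂ : Submodule F (κ → F)}
    (h₁ : C₁ ≤ D₁) (h₂ : C₂ ≤ D₂) : tensor C₁ C₂ ≤ tensor D₁ D₂ :=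
  fun _ hc => ⟨fun j => h₁ (hc.1 j), fun i => h₂ (hc.2 i)⟩

theorem dual_anti [Fintype ι] {C D : Submodule F (ι → F)} (h : C ≤ D) : dual D ≤ dual C :=
  fun _ hx y hy => hx y (h hy)

/-- The standard bilinear form. -/
def dotForm (F ι : Type*) [Field F] [Fintype ι] : LinearMap.BilinForm F (ι → F) :=
  dotProductBilin F F

theorem dotForm_apply [Fintype ι] (x y : ι → F) : dotForm F ι x y = x ⬝ᵥ y := rfl

theorem dotForm_isRefl [Fintype ι] : (dotForm F ι).IsRefl := fun x y h => by
  rw [dotForm_apply] at h ⊢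
  rw [dotProduct_comm, h]

theorem dotForm_nondegenerate [Fintype ι] : (dotForm F ι).Nondegenerate := by
  classical
  refine (LinearMap.IsRefl.nondegenerate_iff_separatingLeft (B := dotForm F ι) dotForm_isRefl).2
    fun x hx => ?_
  exact dotProduct_eq_zero x fun y => hx y

theorem dual_eq_orthogonal [Fintype ι] (C : Submodule F (ι → F)) :
    dual C = (dotForm F ι).orthogonal C := by
  ext x
  rw [mem_dual, LinearMap.BilinForm.mem_orthogonal_iff]
  refine forall₂_congr fun y _ => ?_
  rw [dotForm_apply, dotProduct_comm]

theorem dual_dual [Fintype ι] (C : Submodule F (ι → F)) : dual (dual C) = C := by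
  rw [dual_eq_orthogonal, dual_eq_orthogonal]
  exact LinearMap.BilinForm.orthogonal_orthogonal dotForm_nondegenerate dotForm_isRefl C

theorem finrank_dual [Fintype ι] (C : Submodule F (ι → F)) :
    finrank F (dual C) = Fintype.card ι - finrank F C := by
  rw [dual_eq_orthogonal, LinearMap.BilinForm.finrank_orthogonal dotForm_nondegenerate,
    finrank_fintype_fun_eq_card]

theorem dual_inf_le_sup [Fintype ι] (A B : Submodule F (ι → F)) :
    dual (dual A ⊓ dual B) ≤ A ⊔ B := by
  conv_rhs => rw [← dual_dual (A ⊔ B)]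
  refine dual_anti fun x hx => ⟨dual_anti le_sup_left hx, dual_anti le_sup_right hx⟩

/-- The rank-one matrix `x yᵀ`. -/
def outer (x : ι → F) (y : κ → F) : ι × κ → F := fun p => x p.1 * y p.2

theorem outer_mem_tensor {C₁ : Submodule F (ι → F)} {C₂ : Submodule F (κ → F)} {x : ι → F}
    {y : κ → F} (hx : x ∈ C₁) (hy : y ∈ C₂) : outer x y ∈ tensor C₁ C₂ := by
  refine ⟨fun j => ?_, fun i => C₂.smul_mem (x i) hy⟩
  convert C₁.smul_mem (y j) hx using 1
  ext i
  exact mul_comm _ _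

theorem exists_projection_onto (C : Submodule F (κ → F)) :
    ∃ π : (κ → F) →ₗ[F] (κ → F), (∀ v, π v ∈ C) ∧ ∀ v ∈ C, π v = v := by
  obtain ⟨g, hg⟩ := C.subtype.exists_leftInverse_of_injective C.ker_subtype
  refine ⟨C.subtype ∘ₗ g, fun v => (g v).2, fun v hv => ?_⟩
  exact congrArg Subtype.val (LinearMap.congr_fun hg ⟨v, hv⟩)

theorem tensor_eq_span [Fintype κ] (C₁ : Submodule F (ι → F)) (C₂ : Submodule F (κ → F)) :
    tensor C₁ C₂ = Submodule.span F {c | ∃ x ∈ C₁, ∃ y ∈ C₂, c = outer x y} := by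
  classical
  refine le_antisymm (fun c hc => ?_) (Submodule.span_le.2 ?_)
  · obtain ⟨π, hπ, hπ'⟩ := exists_projection_onto C₂
    -- The projection onto `C₂` fixes every row of `c`, so it can be applied to the standard basis
    -- vectors of the column-by-column expansion.
    have : c = ∑ j, outer (fun i => c (i, j)) (π (Pi.single j 1)) := by
      ext ⟨i, j⟩
      have h := hπ' _ (hc.2 i)
      conv_lhs => rw [show c (i, j) = (fun j => c (i, j)) j from rfl, ← h,
        pi_eq_sum_univ' (fun j => c (i, j)), map_sum]
      simp [outer, Finset.sum_apply]
    rw [this]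
    exact Submodule.sum_mem _ fun j _ => Submodule.subset_span ⟨_, hc.1 j, _, hπ _, rfl⟩
  · rintro _ ⟨x, hx, y, hy, rfl⟩
    exact outer_mem_tensor hx hy

theorem finrank_tensor [Fintype ι] [Fintype κ] (C₁ : Submodule F (ι → F))
    (C₂ : Submodule F (κ → F)) :
    finrank F (tensor C₁ C₂) = finrank F C₁ * finrank F C₂ := by
  let b := Module.finBasis F C₂
  let f : (Fin (finrank F C₂) → C₁) →ₗ[F] (ι × κ → F) :=
    { toFun := fun c => ∑ l, outer (c l : ι → F) (b l : κ → F)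
      map_add' := fun c d => by
        ext p
        simp [outer, Finset.sum_apply, add_mul, Finset.sum_add_distrib]
      map_smul' := fun a c => by
        ext p
        simp [outer, Finset.sum_apply, Finset.mul_sum, mul_assoc] }
  have hf : Function.Injective f := by
    rw [← LinearMap.ker_eq_bot, LinearMap.ker_eq_bot']
    intro c hc
    ext l i
    have h := Fintype.linearIndependent_iff.1 b.linearIndependent (fun l => (c l : ι → F) i) ?_ l
    · exact h
    · ext j
      have := congrFun hc (i, j)
      simpa [f, outer, Finset.sum_apply] using this
  have hr : LinearMap.range f = tensor C₁ C₂ := by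
    refine le_antisymm ?_ ?_
    · rintro _ ⟨c, rfl⟩
      change ∑ l, outer (c l : ι → F) (b l : κ → F) ∈ _
      exact Submodule.sum_mem _ fun l _ => outer_mem_tensor (c l).2 (b l).2
    · rw [tensor_eq_span, Submodule.span_le]
      rintro _ ⟨x, hx, y, hy, rfl⟩
      refine ⟨fun l => b.repr ⟨y, hy⟩ l • ⟨x, hx⟩, ?_⟩
      ext ⟨i, j⟩
      have h := congrFun (congrArg Subtype.val (b.sum_repr ⟨y, hy⟩)) j
      simp only [f, outer, LinearMap.coe_mk, AddHom.coe_mk, Finset.sum_apply, Submodule.coe_smul,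
        Pi.smul_apply, smul_eq_mul]
      simp only [Submodule.coe_sum, Finset.sum_apply, Submodule.coe_smul, Pi.smul_apply,
        smul_eq_mul] at h
      rw [← h, Finset.mul_sum]
      exact Finset.sum_congr rfl fun l _ => by ring
  rw [← hr, LinearMap.finrank_range_of_inj hf, Module.finrank_pi_fintype]
  simp [mul_comm]

theorem mem_dual_tensor [Fintype ι] [Fintype κ] {C₁ : Submodule F (ι → F)}
    {C₂ : Submodule F (κ → F)} {c : ι × κ → F} :
    c ∈ dual (tensor C₁ C₂) ↔ ∀ x ∈ C₁, ∀ y ∈ C₂, ∑ i, x i * ∑ j, c (i, j) * y j = 0 := by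
  have key : ∀ (x : ι → F) (y : κ → F),
      c ⬝ᵥ outer x y = ∑ i, x i * ∑ j, c (i, j) * y j := fun x y => by
    rw [dotProduct, Fintype.sum_prod_type]
    refine Finset.sum_congr rfl fun i _ => ?_
    rw [Finset.mul_sum]
    exact Finset.sum_congr rfl fun j _ => by simp only [outer]; ring
  refine ⟨fun h x hx y hy => key x y ▸ h _ (outer_mem_tensor hx hy), fun h t ht => ?_⟩
  rw [tensor_eq_span] at ht
  induction ht using Submodule.span_induction with
  | mem t ht =>
    obtain ⟨x, hx, y, hy, rfl⟩ := ht
    rw [key, h x hx y hy]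
  | zero => exact dotProduct_zero c
  | add s t _ _ hs ht => rw [dotProduct_add, hs, ht, add_zero]
  | smul a t _ ht => rw [dotProduct_smul, ht, smul_zero]

/-- A word orthogonal to a tensor code, multiplied by a word of the second factor, is orthogonal
to the first factor. -/
theorem mulVec_mem_dual [Fintype ι] [Fintype κ] {C₁ : Submodule F (ι → F)}
    {C₂ : Submodule F (κ → F)} {c : ι × κ → F} (hc : c ∈ dual (tensor C₁ C₂)) {y : κ → F}
    (hy : y ∈ C₂) : (fun i => ∑ j, c (i, j) * y j) ∈ dual C₁ := fun x hx => by
  rw [dotProduct_comm]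
  exact mem_dual_tensor.1 hc x hx y hy

theorem mulVec_mem {C₁ : Submodule F (ι → F)} [Fintype κ] {c : ι × κ → F}
    (hc : ∀ j, (fun i => c (i, j)) ∈ C₁) (y : κ → F) :
    (fun i => ∑ j, c (i, j) * y j) ∈ C₁ := by
  have : (fun i => ∑ j, c (i, j) * y j) = ∑ j, y j • fun i => c (i, j) := by
    ext i
    simp [Finset.sum_apply, mul_comm]
  rw [this]
  exact Submodule.sum_mem _ fun j _ => C₁.smul_mem _ (hc j)

theorem tensor_dual_left_le [Fintype ι] [Fintype κ] (C₁ : Submodule F (ι → F))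
    (C₂ : Submodule F (κ → F)) : tensor (dual C₁) ⊤ ≤ dual (tensor C₁ C₂) := fun c hc => by
  refine mem_dual_tensor.2 fun x hx y _ => ?_
  have h := mulVec_mem hc.1 y x hx
  rwa [dotProduct_comm] at h

theorem tensor_dual_right_le [Fintype ι] [Fintype κ] (C₁ : Submodule F (ι → F))
    (C₂ : Submodule F (κ → F)) : tensor ⊤ (dual C₂) ≤ dual (tensor C₁ C₂) := fun c hc => by
  refine mem_dual_tensor.2 fun x _ y hy => Finset.sum_eq_zero fun i _ => ?_
  have h := hc.2 i y hy
  rw [dotProduct] at h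
  rw [h, mul_zero]

/-- By double duality it is enough that a matrix orthogonal to both summands lies in `tensor C₁ C₂`.
Testing it against rank-one matrices with one factor a standard basis vector isolates its columns
and rows. -/
theorem dual_tensor_le [Fintype ι] [Fintype κ] (C₁ : Submodule F (ι → F))
    (C₂ : Submodule F (κ → F)) :
    dual (tensor C₁ C₂) ≤ tensor (dual C₁) ⊤ ⊔ tensor ⊤ (dual C₂) := by
  classical
  refine le_trans (dual_anti ?_) (dual_inf_le_sup _ _)
  intro c hc
  refine ⟨fun j => ?_, fun i => ?_⟩
  · rw [← dual_dual C₁]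
    intro x hx
    have h := hc.1 (outer x (Pi.single j 1)) (outer_mem_tensor hx trivial)
    rw [dotProduct, Fintype.sum_prod_type] at h
    simpa [outer, Pi.single_apply, dotProduct] using h
  · rw [← dual_dual C₂]
    intro y hy
    have h := hc.2 (outer (Pi.single i 1) y) (outer_mem_tensor trivial hy)
    rw [dotProduct, Fintype.sum_prod_type, Finset.sum_comm] at h
    simpa [outer, Pi.single_apply, dotProduct] using h

/-- Contracting the rows with `y ∈ X₂` gives a vector of `K₁ ⊓ dual X₁`, hence zero; so each row
lies in `K₂ ⊓ dual X₂`. With `K₁`, `K₂` complements of the duals, `tensor K₁ K₂` carries the logical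
space of the product code. -/
theorem tensor_inf_dual_eq_bot [Fintype ι] [Fintype κ] {K₁ X₁ : Submodule F (ι → F)}
    {K₂ X₂ : Submodule F (κ → F)} (h₁ : K₁ ⊓ dual X₁ = ⊥) (h₂ : K₂ ⊓ dual X₂ = ⊥) :
    tensor K₁ K₂ ⊓ dual (tensor X₁ X₂) = ⊥ := by
  rw [eq_bot_iff]
  rintro c ⟨hc, hd⟩
  rw [Submodule.mem_bot]
  ext ⟨i, j⟩
  have hrow : (fun j => c (i, j)) ∈ K₂ ⊓ dual X₂ := by
    refine ⟨hc.2 i, fun y hy => ?_⟩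
    have h : (fun i => ∑ j, c (i, j) * y j) ∈ K₁ ⊓ dual X₁ :=
      ⟨mulVec_mem hc.1 y, mulVec_mem_dual hd hy⟩
    rw [h₁, Submodule.mem_bot] at h
    exact congrFun h i
  rw [h₂, Submodule.mem_bot] at hrow
  exact congrFun hrow j

theorem tensor_sup_sup_le [Fintype κ] (A₁ K₁ : Submodule F (ι → F))
    (A₂ K₂ : Submodule F (κ → F)) :
    tensor (A₁ ⊔ K₁) (A₂ ⊔ K₂) ≤
      tensor K₁ K₂ ⊔ (tensor A₁ (A₂ ⊔ K₂) ⊔ tensor (A₁ ⊔ K₁) A₂) := by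
  conv_lhs => rw [tensor_eq_span]
  rw [Submodule.span_le]
  rintro _ ⟨x, hx, y, hy, rfl⟩
  obtain ⟨a₁, ha₁, b₁, hb₁, rfl⟩ := Submodule.mem_sup.1 hx
  obtain ⟨a₂, ha₂, b₂, hb₂, rfl⟩ := Submodule.mem_sup.1 hy
  have : outer (a₁ + b₁) (a₂ + b₂) =
      outer b₁ b₂ + (outer a₁ (a₂ + b₂) + outer b₁ a₂) := by
    ext p
    simp only [outer, Pi.add_apply]
    ring
  rw [this]
  refine Submodule.add_mem_sup (outer_mem_tensor hb₁ hb₂)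
    (Submodule.add_mem_sup (outer_mem_tensor ha₁ hy) (outer_mem_tensor ?_ ha₂))
  exact Submodule.mem_sup_right hb₁

end Codes

/-! ### Dimension, stabilizer and locality of the subsystem product. -/

namespace SubsystemCode

variable {F : Type*} [Field F] {ι κ : Type*} [Fintype ι] [Fintype κ]

theorem IsCSS.exists_complement {Q : SubsystemCode F ι} (h : Q.IsCSS) :
    ∃ K : Submodule F (ι → F), K ⊓ dual Q.X = ⊥ ∧ dual Q.X ⊔ K = Q.Z := by
  obtain ⟨K, hK⟩ := exists_isCompl (dual Q.X)
  refine ⟨K ⊓ Q.Z, ?_, ?_⟩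
  · rw [eq_bot_iff, ← hK.inf_eq_bot]
    exact le_inf inf_le_right (inf_le_left.trans inf_le_left)
  · rw [← sup_inf_assoc_of_le K h, hK.sup_eq_top, top_inf_eq]

theorem IsCSS.dimension_eq {Q : SubsystemCode F ι} (h : Q.IsCSS) {K : Submodule F (ι → F)}
    (h₁ : K ⊓ dual Q.X = ⊥) (h₂ : dual Q.X ⊔ K = Q.Z) : Q.dimension = finrank F K := by
  have := Submodule.finrank_sup_add_finrank_inf_eq K (dual Q.X)
  rw [h₁, sup_comm, h₂, finrank_bot] at this
  rw [dimension, sup_eq_left.2 h]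
  omega

/-- Split each `Z` as the dual of `X` plus a complement `K`. In the expansion of the tensor product
every term except `tensor K₁ K₂` lies in the dual of `tensor X₁ X₂`, and that one meets it
trivially. -/
theorem prod_dimension {Q : SubsystemCode F ι} {R : SubsystemCode F κ} (hQ : Q.IsCSS)
    (hR : R.IsCSS) : (Q.prod R).dimension = Q.dimension * R.dimension := by
  obtain ⟨K₁, h₁, h₁'⟩ := hQ.exists_complement
  obtain ⟨K₂, h₂, h₂'⟩ := hR.exists_complement
  have hK := tensor_inf_dual_eq_bot h₁ h₂
  rw [hQ.dimension_eq h₁ h₁', hR.dimension_eq h₂ h₂', ← finrank_tensor]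
  have hsup : (Q.prod R).Z ⊔ dual (Q.prod R).X = tensor K₁ K₂ ⊔ dual (tensor Q.X R.X) := by
    refine le_antisymm (sup_le ?_ le_sup_right) (sup_le_sup_right ?_ _)
    · change tensor Q.Z R.Z ≤ _
      rw [← h₁', ← h₂']
      refine (tensor_sup_sup_le _ _ _ _).trans (sup_le_sup_left (sup_le ?_ ?_) _)
      · exact (tensor_mono le_rfl le_top).trans (tensor_dual_left_le _ _)
      · exact (tensor_mono le_top le_rfl).trans (tensor_dual_right_le _ _)
    · refine tensor_mono ?_ ?_
      · rw [← h₁']; exact le_sup_right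
      · rw [← h₂']; exact le_sup_right
  have := Submodule.finrank_sup_add_finrank_inf_eq (tensor K₁ K₂) (dual (tensor Q.X R.X))
  rw [hK, finrank_bot] at this
  rw [dimension, hsup]
  change _ - finrank F (dual (tensor Q.X R.X)) = _
  omega

theorem prod_stab_le {Q : SubsystemCode F ι} {R : SubsystemCode F κ} (hQ : Q.IsCSS)
    (hR : R.IsCSS) :
    (Q.prod R).stab ≤ tensor (dual Q.X) R.Z ⊔ tensor Q.Z (dual R.X) := by
  obtain ⟨K₁, h₁, h₁'⟩ := hQ.exists_complement
  obtain ⟨K₂, h₂, h₂'⟩ := hR.exists_complement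
  rintro c ⟨hc, hd⟩
  change c ∈ tensor Q.Z R.Z at hc
  change c ∈ dual (tensor Q.X R.X) at hd
  rw [← h₁', ← h₂'] at hc
  obtain ⟨k, hk, s, hs, rfl⟩ := Submodule.mem_sup.1 (tensor_sup_sup_le _ _ _ _ hc)
  rw [h₁', h₂'] at hs
  have hs' : s ∈ dual (tensor Q.X R.X) := by
    refine (sup_le ?_ ?_ : _ ≤ dual (tensor Q.X R.X)) hs
    · exact (tensor_mono le_rfl le_top).trans (tensor_dual_left_le _ _)
    · exact (tensor_mono le_top le_rfl).trans (tensor_dual_right_le _ _)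
  have hk' : k ∈ tensor K₁ K₂ ⊓ dual (tensor Q.X R.X) :=
    ⟨hk, by simpa using Submodule.sub_mem _ hd hs'⟩
  rw [tensor_inf_dual_eq_bot h₁ h₂, Submodule.mem_bot] at hk'
  rwa [hk', zero_add]

/-- The identity minus a projection onto `C` has kernel `C`. -/
theorem exists_square_check (C : Submodule F (ι → F)) :
    ∃ H : Matrix ι ι F, LinearMap.ker H.mulVecLin = C := by
  classical
  obtain ⟨π, hπ, hπ'⟩ := exists_projection_onto C
  refine ⟨LinearMap.toMatrix' (LinearMap.id - π), ?_⟩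
  rw [← Matrix.toLin'_apply', Matrix.toLin'_toMatrix']
  ext v
  rw [LinearMap.mem_ker, LinearMap.sub_apply, LinearMap.id_apply, sub_eq_zero]
  exact ⟨fun h => h ▸ hπ v, fun h => (hπ' v h).symm⟩

theorem weight_le_card (x : ι → F) (s : Finset ι) (h : ∀ i, x i ≠ 0 → i ∈ s) :
    weight x ≤ s.card := by
  classical
  exact Finset.card_le_card fun i hi => h i (Finset.mem_filter.1 hi).2

theorem hasSparseCheck_of_fintype {C : Submodule F (ι → F)} {w : ℕ} {μ : Type*} [Fintype μ]
    (H : Matrix μ ι F) (hC : LinearMap.ker H.mulVecLin = C)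
    (hrow : ∀ i, weight (fun j => H i j) ≤ w) (hcol : ∀ j, weight (fun i => H i j) ≤ w) :
    HasSparseCheck C w := by
  classical
  let e := Fintype.equivFin μ
  refine ⟨Fintype.card μ, H.submatrix e.symm id, ?_, fun i => hrow _, fun j => ?_⟩
  · rw [← hC]
    ext v
    rw [LinearMap.mem_ker, LinearMap.mem_ker, funext_iff, funext_iff]
    refine ⟨fun h i => ?_, fun h i => h (e.symm i)⟩
    have := h (e i)
    simp only [Matrix.mulVecLin_apply, Matrix.mulVec, Matrix.submatrix_apply,
      Equiv.symm_apply_apply] at this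
    exact this
  · refine le_trans (le_of_eq ?_) (hcol j)
    unfold weight hammingNorm
    exact Finset.card_equiv e.symm fun i => by
      rw [Finset.mem_filter_univ, Finset.mem_filter_univ]
      rfl

/-- Impose a square check matrix separately on every column and every row. Each check sees one line
of the matrix, while each entry is seen only by the checks of its own column and its own row, hence
the sum of the two lengths. -/
theorem hasSparseCheck_tensor (C₁ : Submodule F (ι → F)) (C₂ : Submodule F (κ → F)) :
    HasSparseCheck (tensor C₁ C₂) (Fintype.card ι + Fintype.card κ) := by
  classical
  obtain ⟨H₁, h₁⟩ := exists_square_check C₁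
  obtain ⟨H₂, h₂⟩ := exists_square_check C₂
  let H : Matrix ((ι × κ) ⊕ (ι × κ)) (ι × κ) F := fun p x => Sum.elim
    (fun a => if a.2 = x.2 then H₁ a.1 x.1 else 0) (fun a => if a.1 = x.1 then H₂ a.2 x.2 else 0) p
  refine hasSparseCheck_of_fintype H ?_ ?_ ?_
  · ext c
    have m₁ : ∀ v, v ∈ C₁ ↔ ∀ i, ∑ i', H₁ i i' * v i' = 0 := fun v => by
      rw [← h₁, LinearMap.mem_ker, funext_iff]; rfl
    have m₂ : ∀ v, v ∈ C₂ ↔ ∀ i, ∑ i', H₂ i i' * v i' = 0 := fun v => by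
      rw [← h₂, LinearMap.mem_ker, funext_iff]; rfl
    rw [LinearMap.mem_ker, funext_iff, Sum.forall, mem_tensor]
    refine and_congr ?_ ?_
    · simp_rw [m₁]
      rw [Prod.forall, forall_comm]
      refine forall₂_congr fun j i => ?_
      rw [Matrix.mulVecLin_apply]
      simp [H, Matrix.mulVec, dotProduct, Fintype.sum_prod_type]
    · simp_rw [m₂]
      rw [Prod.forall]
      refine forall₂_congr fun j i => ?_
      rw [Matrix.mulVecLin_apply]
      simp [H, Matrix.mulVec, dotProduct, Fintype.sum_prod_type_right]
  · rintro (⟨i, j⟩ | ⟨i, j⟩)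
    · refine (weight_le_card _ (Finset.univ.image fun i' => (i', j)) ?_).trans
        (Finset.card_image_le.trans (Nat.le_add_right _ _))
      rintro ⟨i', j'⟩ h
      simp only [H, Sum.elim_inl, ne_eq, ite_eq_right_iff, Classical.not_imp] at h
      simp [h.1]
    · refine (weight_le_card _ (Finset.univ.image fun j' => (i, j')) ?_).trans
        (Finset.card_image_le.trans (Nat.le_add_left _ _))
      rintro ⟨i', j'⟩ h
      simp only [H, Sum.elim_inr, ne_eq, ite_eq_right_iff, Classical.not_imp] at h
      simp [h.1]
  · rintro ⟨i, j⟩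
    refine (weight_le_card _ ((Finset.univ.image fun i' => Sum.inl (i', j)) ∪
      (Finset.univ.image fun j' => Sum.inr (i, j'))) ?_).trans
        ((Finset.card_union_le _ _).trans (add_le_add Finset.card_image_le Finset.card_image_le))
    rintro (⟨i', j'⟩ | ⟨i', j'⟩) h
    · simp only [H, Sum.elim_inl, ne_eq, ite_eq_right_iff, Classical.not_imp] at h
      simp [h.1]
    · simp only [H, Sum.elim_inr, ne_eq, ite_eq_right_iff, Classical.not_imp] at h
      simp [h.1]

theorem prod_hasLocality (Q : SubsystemCode F ι) (R : SubsystemCode F κ) :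
    (Q.prod R).HasLocality (Fintype.card ι + Fintype.card κ) :=
  ⟨hasSparseCheck_tensor _ _, hasSparseCheck_tensor _ _⟩

end SubsystemCode

/-! ### Divisibility of bivariate polynomials from divisibility on lines. -/

section Bivariate

open Polynomial.Bivariate

variable {F : Type*} [Field F]

/-- The outer variable is `Y`: `f.eval (C y)` restricts to a horizontal line, `f.natDegree` is the
`Y`-degree, and `swap` gives access to vertical lines and to the `X`-degree. -/
theorem eval_C_eq_map_swap (f : F[X][Y]) (y : F) :
    f.eval (C y) = (swap f).map (evalRingHom y) := by
  induction f using Polynomial.induction_on' with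
  | add p q hp hq => rw [eval_add, hp, hq, map_add, Polynomial.map_add]
  | monomial n p =>
    rw [swap_monomial, eval_monomial, Polynomial.map_mul, map_map, map_C]
    have : (evalRingHom y).comp C = RingHom.id F := by ext; simp
    rw [this, map_id]
    simp

theorem eval_swap_eval (f : F[X][Y]) (x y : F) :
    ((swap f).eval (C x)).eval y = (f.eval (C y)).eval x := by
  rw [eval_C_eq_map_swap (swap f), swap_swap_apply]
  exact map_evalRingHom_eval x y f

theorem degree_eval_C_le (f : F[X][Y]) (y : F) : (f.eval (C y)).degree ≤ (swap f).degree := by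
  rw [eval_C_eq_map_swap]
  exact degree_map_le

theorem eq_zero_of_eval_C_eq_zero {f : F[X][Y]} {s : Finset F} (hf : f.degree < s.card)
    (h : ∀ y ∈ s, f.eval (C y) = 0) : f = 0 := by
  classical
  refine eq_zero_of_degree_lt_of_eval_finset_eq_zero (s.image C) ?_ ?_
  · rwa [Finset.card_image_of_injective _ C_injective]
  · intro x hx
    obtain ⟨y, hy, rfl⟩ := Finset.mem_image.1 hx
    exact h y hy

theorem card_le_natDegree_of_eval_C_eq_zero {f : F[X][Y]} (hf : f ≠ 0) {s : Finset F}
    (h : ∀ y ∈ s, f.eval (C y) = 0) : s.card ≤ f.natDegree := by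
  by_contra! hlt
  exact hf (eq_zero_of_eval_C_eq_zero (natDegree_lt_iff_degree_lt hf |>.1 hlt) h)

theorem swap_ne_zero {f : F[X][Y]} (hf : f ≠ 0) : swap f ≠ 0 :=
  (map_ne_zero_iff _ (swap (R := F)).injective).2 hf

/-- The bivariate polynomial with coefficient array `g`. -/
def biPoly (s t : ℕ) : (Fin s × Fin t → F) →ₗ[F] F[X][Y] where
  toFun g := ∑ p, monomial (p.2 : ℕ) (monomial (p.1 : ℕ) (g p))
  map_add' g h := by simp [Finset.sum_add_distrib]
  map_smul' c g := by simp [Finset.smul_sum, smul_monomial]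

theorem biPoly_apply (s t : ℕ) (g : Fin s × Fin t → F) :
    biPoly s t g = ∑ p, monomial (p.2 : ℕ) (monomial (p.1 : ℕ) (g p)) := rfl

theorem coeff_coeff_biPoly {s t : ℕ} (g : Fin s × Fin t → F) (p : Fin s × Fin t) :
    ((biPoly s t g).coeff p.2).coeff p.1 = g p := by
  rw [biPoly_apply, finsetSum_coeff, finsetSum_coeff, Finset.sum_eq_single p]
  · simp
  · rintro q - hq
    rw [coeff_monomial]
    split_ifs with h
    · rw [coeff_monomial, if_neg]
      exact fun h' => hq (Prod.ext (Fin.ext h') (Fin.ext h))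
    · simp
  · simp

theorem biPoly_injective (s t : ℕ) : Function.Injective (biPoly (F := F) s t) := fun g h e => by
  ext p
  rw [← coeff_coeff_biPoly g p, e, coeff_coeff_biPoly]

theorem degree_biPoly_lt {s t : ℕ} (g : Fin s × Fin t → F) : (biPoly s t g).degree < t := by
  rw [← mem_degreeLT, biPoly_apply]
  refine Submodule.sum_mem _ fun p _ => mem_degreeLT.2 ?_
  exact (degree_monomial_le _ _).trans_lt (by exact_mod_cast p.2.2)

theorem degree_swap_biPoly_lt {s t : ℕ} (g : Fin s × Fin t → F) :
    (swap (biPoly s t g)).degree < s := by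
  rw [← mem_degreeLT, biPoly_apply, map_sum]
  refine Submodule.sum_mem _ fun p _ => mem_degreeLT.2 ?_
  rw [swap_monomial_monomial]
  exact (degree_monomial_le _ _).trans_lt (by exact_mod_cast p.1.2)

theorem degree_add_lt {a b : WithBot ℕ} {m n : ℕ} (ha : a ≤ m) (hb : b < n) :
    a + b < ((m + n : ℕ) : WithBot ℕ) := by
  rw [Nat.cast_add]
  exact (add_le_add_left ha b).trans_lt
    (WithBot.add_lt_add_left (WithBot.natCast_ne_bot m) hb)

theorem degree_mul_lt {R : Type*} [CommRing R] [IsDomain R] {f g : R[X]} {m n : ℕ}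
    (hf : f.degree ≤ m) (hg : g.degree < n) : (f * g).degree < ((m + n : ℕ) : WithBot ℕ) := by
  rw [degree_mul]
  exact degree_add_lt hf hg

theorem degree_lt_of_mul {R : Type*} [CommRing R] [IsDomain R] {f g : R[X]} {n : ℕ}
    (hf : f ≠ 0) (h : (f * g).degree < ((f.natDegree + n : ℕ) : WithBot ℕ)) : g.degree < n := by
  rcases eq_or_ne g 0 with rfl | hg
  · simp
  rw [degree_mul, degree_eq_natDegree hf, degree_eq_natDegree hg] at h
  rw [degree_eq_natDegree hg]
  norm_cast at h ⊢
  omega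

/-- Two coprime bivariate polynomials cannot divide each other on too many lines. -/
theorem not_isRelPrime_of_dvd_on_lines {E P : F[X][Y]} {d e : ℕ} (hE : E ≠ 0)
    (hle : (swap E).natDegree ≤ E.natDegree) (hpos : 0 < E.natDegree)
    (hP : (swap P).degree < ((swap E).natDegree + d : ℕ)) {s : Finset F}
    (hs : E.natDegree + (swap E).natDegree + d + e < s.card)
    (hdvd : ∀ x ∈ s, ∃ r : F[X], r.degree < e ∧
      (swap P).eval (C x) = (swap E).eval (C x) * r) : ¬ IsRelPrime E P := by
  intro hrel
  have hdvd' : ∀ x : s, ∃ r : F[X], r.degree < e ∧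
      (swap P).eval (C (x : F)) = (swap E).eval (C (x : F)) * r := fun x => hdvd x x.2
  choose r hr hr' using hdvd'
  set a := E.natDegree with ha
  set b := (swap E).natDegree with hb
  -- Unknowns `U`, `V` have `X`-degrees below `m`, `l` and `Y`-degrees below `a + e`, `a`. Thus `U *
  -- E + V * P` has `X`-degree below `s.card`, and `E` can divide `V` only if `V = 0`.
  obtain ⟨m, hm⟩ : ∃ m, s.card = b + m := ⟨s.card - b, by omega⟩
  obtain ⟨l, hl⟩ : ∃ l, s.card = l + (b + d) := ⟨s.card - (b + d), by omega⟩
  let line : F → F[X][Y] →ₗ[F] F[X] := fun x =>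
    { toFun := fun f => (swap f).eval (C x)
      map_add' := fun f g => by simp
      map_smul' := fun c f => by simp }
  let Ψ : ((Fin m × Fin (a + e) → F) × (Fin l × Fin a → F)) →ₗ[F] (s × Fin (a + e) → F) :=
    LinearMap.pi fun q => (lcoeff F (q.2 : ℕ)) ∘ₗ
      ((line q.1 ∘ₗ biPoly m (a + e)) ∘ₗ LinearMap.fst F _ _ +
        LinearMap.mulRight F (r q.1) ∘ₗ (line q.1 ∘ₗ biPoly l a) ∘ₗ LinearMap.snd F _ _)
  -- There are `a + e` equations for each point of `s`. Unknowns outnumber them because `s.card * a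
  -- > (a + b + d + e) * a ≥ b * (a + e) + (b + d) * a`, the last step using `b ≤ a`.
  have hker : LinearMap.ker Ψ ≠ ⊥ := by
    apply LinearMap.ker_ne_bot_of_finrank_lt
    rw [finrank_prod]
    simp only [finrank_fintype_fun_eq_card, Fintype.card_prod, Fintype.card_fin,
      Fintype.card_coe]
    have h₁ : s.card * (a + e) = b * (a + e) + m * (a + e) := by rw [hm]; ring
    have h₂ : s.card * a = l * a + (b + d) * a := by rw [hl]; ring
    have h₃ : (a + b + d + e) * a < s.card * a := Nat.mul_lt_mul_of_pos_right hs hpos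
    have h₄ : b * e ≤ a * e := Nat.mul_le_mul_right e hle
    have h₅ : b * a ≤ a * a := Nat.mul_le_mul_right a hle
    nlinarith
  obtain ⟨⟨g, h⟩, hgh, hne⟩ := Submodule.exists_mem_ne_zero_of_ne_bot hker
  set U := biPoly m (a + e) g with hU
  set V := biPoly l a h with hV
  have hzero : ∀ x : s, (swap U).eval (C (x : F)) + (swap V).eval (C (x : F)) * r x = 0 := by
    intro x
    have hdeg : ((swap U).eval (C (x : F)) + (swap V).eval (C (x : F)) * r x).degree <
        (a + e : ℕ) := by
      refine (degree_add_le _ _).trans_lt (max_lt ?_ ?_)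
      · exact (degree_eval_C_le _ _).trans_lt (by
          rw [swap_swap_apply]; exact degree_biPoly_lt g)
      · refine degree_mul_lt ((degree_eval_C_le _ _).trans ?_) (hr x)
        rw [swap_swap_apply]
        exact (degree_biPoly_lt h).le
    ext n
    by_cases hn : n < a + e
    · exact congrFun hgh (x, ⟨n, hn⟩)
    · rw [coeff_zero]
      exact coeff_eq_zero_of_degree_lt (hdeg.trans_le (by exact_mod_cast not_lt.1 hn))
  have hcomb : U * E + V * P = 0 := by
    apply (swap (R := F)).injective
    rw [map_zero]
    refine eq_zero_of_eval_C_eq_zero (s := s) ?_ fun x hx => ?_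
    · rw [map_add, map_mul, map_mul]
      refine (degree_add_le _ _).trans_lt (max_lt ?_ ?_)
      · rw [mul_comm, hm]
        exact degree_mul_lt degree_le_natDegree (degree_swap_biPoly_lt g)
      · rw [hl]
        exact degree_mul_lt (degree_swap_biPoly_lt h).le hP
    · have := hzero ⟨x, hx⟩
      rw [map_add, map_mul, map_mul, eval_add, eval_mul, eval_mul, hr' ⟨x, hx⟩]
      linear_combination (swap E).eval (C x) * this
  have hEV : E ∣ V := by
    refine hrel.dvd_of_dvd_mul_right (y := V) ⟨-U, ?_⟩
    linear_combination hcomb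
  have hV0 : V = 0 := by
    by_contra hV0
    have h₁ := natDegree_le_of_dvd hEV hV0
    have h₂ := (natDegree_lt_iff_degree_lt hV0).2 (degree_biPoly_lt h)
    omega
  have hU0 : U = 0 := by
    rw [hV0, zero_mul, add_zero] at hcomb
    exact (mul_eq_zero.1 hcomb).resolve_right hE
  apply hne
  rw [Prod.mk_eq_zero]
  exact ⟨biPoly_injective _ _ (by rw [map_zero]; exact hU0),
    biPoly_injective _ _ (by rw [map_zero]; exact hV0)⟩

theorem isRelPrime_swap {E P : F[X][Y]} (h : IsRelPrime E P) : IsRelPrime (swap E) (swap P) := by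
  intro d hE hP
  have hu : IsUnit (swap d) := h (by simpa only [swap_swap_apply] using map_dvd (swap (R := F)) hE)
    (by simpa only [swap_swap_apply] using map_dvd (swap (R := F)) hP)
  simpa only [swap_swap_apply] using hu.map (swap (R := F))

theorem card_sub_le_card_filter {G : F[X][Y]} (hG : G ≠ 0) (s : Finset F) :
    open Classical in s.card ≤ (s.filter fun y => G.eval (C y) ≠ 0).card + G.natDegree := by
  classical
  have h := card_le_natDegree_of_eval_C_eq_zero hG (s := s.filter fun y => G.eval (C y) = 0)
    fun y hy => (Finset.mem_filter.1 hy).2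
  have := Finset.card_filter_add_card_filter_not (s := s) (fun y => G.eval (C y) = 0)
  simp only [ne_eq] at this ⊢
  omega

theorem isUnit_of_natDegree_eq_zero {E : F[X][Y]} (hE : E ≠ 0) (h : E.natDegree = 0)
    (h' : (swap E).natDegree = 0) : IsUnit E := by
  rw [eq_C_of_natDegree_eq_zero h, swap_C, natDegree_map_eq_of_injective C_injective] at h'
  rw [eq_C_of_natDegree_eq_zero h, eq_C_of_natDegree_eq_zero h']
  refine isUnit_C.2 (isUnit_C.2 (isUnit_iff_ne_zero.2 fun h0 => hE ?_))
  rw [eq_C_of_natDegree_eq_zero h, eq_C_of_natDegree_eq_zero h', h0, C_0, C_0]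

/-- A bivariate polynomial that divides another one on sufficiently many lines parallel to each of
the axes divides it. -/
theorem dvd_of_dvd_on_lines {E P : F[X][Y]} {d e : ℕ} (hE : E ≠ 0)
    (hP : P.degree < (E.natDegree + e : ℕ)) (hP' : (swap P).degree < ((swap E).natDegree + d : ℕ))
    {s t : Finset F} (hs : E.natDegree + (swap E).natDegree + d + e < s.card)
    (ht : E.natDegree + (swap E).natDegree + d + e < t.card)
    (hsd : ∀ x ∈ s, ∃ r : F[X], r.degree < e ∧ (swap P).eval (C x) = (swap E).eval (C x) * r)
    (htd : ∀ y ∈ t, ∃ r : F[X], r.degree < d ∧ P.eval (C y) = E.eval (C y) * r) : E ∣ P := by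
  classical
  -- The common factor `G` vanishes identically on at most as many lines as its degree in the
  -- relevant variable. Discarding them costs no more than the degrees of `E` drop, so the
  -- hypotheses survive for the coprime cofactors.
  obtain ⟨E', P', G, hrel, rfl, rfl⟩ := UniqueFactorizationMonoid.exists_reduced_factors E hE P
  have hG : G ≠ 0 := left_ne_zero_of_mul hE
  have hE' : E' ≠ 0 := right_ne_zero_of_mul hE
  have hsG := swap_ne_zero hG
  have hsE := swap_ne_zero hE'
  rw [map_mul] at hs ht hP'
  rw [map_mul] at hP'
  rw [natDegree_mul hG hE'] at hs ht hP
  rw [natDegree_mul hsG hsE] at hs ht hP'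
  rw [add_assoc] at hP hP'
  have hQ := degree_lt_of_mul hG hP
  have hQ' := degree_lt_of_mul hsG hP'
  have hs' := card_sub_le_card_filter hsG s
  have ht' := card_sub_le_card_filter hG t
  have hsd' : ∀ x ∈ s.filter fun x => (swap G).eval (C x) ≠ 0, ∃ r : F[X], r.degree < e ∧
      (swap P').eval (C x) = (swap E').eval (C x) * r := fun x hx => by
    obtain ⟨hx, hx'⟩ := Finset.mem_filter.1 hx
    obtain ⟨r, hr, h⟩ := hsd x hx
    refine ⟨r, hr, mul_left_cancel₀ hx' ?_⟩
    rw [map_mul, map_mul, eval_mul, eval_mul] at h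
    rw [h, mul_assoc]
  have htd' : ∀ y ∈ t.filter fun y => G.eval (C y) ≠ 0, ∃ r : F[X], r.degree < d ∧
      P'.eval (C y) = E'.eval (C y) * r := fun y hy => by
    obtain ⟨hy, hy'⟩ := Finset.mem_filter.1 hy
    obtain ⟨r, hr, h⟩ := htd y hy
    refine ⟨r, hr, mul_left_cancel₀ hy' ?_⟩
    rw [eval_mul, eval_mul] at h
    rw [h, mul_assoc]
  by_cases h0 : E'.natDegree = 0 ∧ (swap E').natDegree = 0
  · exact mul_dvd_mul_left G (isUnit_of_natDegree_eq_zero hE' h0.1 h0.2).dvd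
  exfalso
  -- The counting argument needs the `Y`-degree to be the larger one; otherwise exchange the
  -- variables.
  rcases le_total (swap E').natDegree E'.natDegree with hle | hle
  · exact not_isRelPrime_of_dvd_on_lines hE' hle (by omega) hQ' (by omega) hsd' hrel
  · refine not_isRelPrime_of_dvd_on_lines (E := swap E') (P := swap P') (d := e) (e := d) hsE
      (by rwa [swap_swap_apply]) (by omega) (by rwa [swap_swap_apply, swap_swap_apply])
      (s := t.filter fun y => G.eval (C y) ≠ 0) ?_ ?_ (isRelPrime_swap hrel)
    · rw [swap_swap_apply]; omega
    · rw [swap_swap_apply, swap_swap_apply]; exact htd'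

end Bivariate

/-! ### Reed-Solomon codes and the bivariate low-degree test. -/

section ReedSolomon

open Polynomial.Bivariate

variable {F : Type*} [Field F] {ι κ : Type*} {α : ι → F} {β : κ → F}

theorem mem_RS {k : ℕ} {v : ι → F} :
    v ∈ RS α k ↔ ∃ f : F[X], f.degree < k ∧ ∀ i, v i = f.eval (α i) := by
  constructor
  · rintro ⟨f, hf, rfl⟩
    refine ⟨f, (degree_lt_iff_coeff_zero _ _).2 fun n hn => hf n ?_, fun i => rfl⟩
    simpa using hn
  · rintro ⟨f, hf, h⟩
    refine ⟨f, fun n hn => (degree_lt_iff_coeff_zero _ _).1 hf n ?_, (funext h).symm⟩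
    simpa using hn

theorem exists_bivariate_of_mem_tensor [Fintype κ] {k₁ k₂ : ℕ} {c : ι × κ → F}
    (hc : c ∈ tensor (RS α k₁) (RS β k₂)) :
    ∃ P : F[X][Y], P.degree < k₂ ∧ (swap P).degree < k₁ ∧
      ∀ i j, c (i, j) = (P.eval (C (β j))).eval (α i) := by
  rw [tensor_eq_span] at hc
  induction hc using Submodule.span_induction with
  | mem c hc =>
    obtain ⟨x, hx, y, hy, rfl⟩ := hc
    obtain ⟨f, hf, hxf⟩ := mem_RS.1 hx
    obtain ⟨g, hg, hyg⟩ := mem_RS.1 hy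
    refine ⟨C f * g.map C, ?_, ?_, fun i j => ?_⟩
    · have := degree_mul_lt (f := C f) (g := g.map C) (m := 0) (n := k₂) degree_C_le
        (degree_map_le.trans_lt hg)
      rwa [zero_add] at this
    · rw [map_mul, swap_C, swap_map_C, mul_comm]
      have := degree_mul_lt (f := C g) (g := f.map C) (m := 0) (n := k₁) degree_C_le
        (degree_map_le.trans_lt hf)
      rwa [zero_add] at this
    · simp [outer, hxf, hyg, eval_map, eval₂_at_apply]
  | zero => exact ⟨0, by simp, by simp, by simp⟩
  | add c d _ _ hc hd =>
    obtain ⟨P, h₁, h₂, h₃⟩ := hc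
    obtain ⟨Q, h₁', h₂', h₃'⟩ := hd
    refine ⟨P + Q, (degree_add_le _ _).trans_lt (max_lt h₁ h₁'), ?_, fun i j => ?_⟩
    · rw [map_add]
      exact (degree_add_le _ _).trans_lt (max_lt h₂ h₂')
    · simp [h₃, h₃']
  | smul a c _ hc =>
    obtain ⟨P, h₁, h₂, h₃⟩ := hc
    refine ⟨a • P, (degree_smul_le _ _).trans_lt h₁, ?_, fun i j => ?_⟩
    · rw [map_smul]
      exact (degree_smul_le _ _).trans_lt h₂
    · simp [h₃]

theorem eq_zero_of_eval_eq_zero [Fintype ι] (hα : Function.Injective α) {f : F[X]}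
    (hf : f.degree < Fintype.card ι) (h : ∀ i, f.eval (α i) = 0) : f = 0 :=
  eq_zero_of_degree_lt_of_eval_index_eq_zero (s := Finset.univ) hα.injOn hf fun i _ => h i

/-- Bivariate low-degree testing: if a matrix with columns in a Reed-Solomon code and a matrix with
rows in another one agree in most places, then the latter agrees in most rows with a word of the
tensor code. -/
theorem exists_mem_tensor_of_agreement [Fintype ι] [Fintype κ] (hα : Function.Injective α)
    (hβ : Function.Injective β) {k₁ k₂ s : ℕ} {u w : ι × κ → F}
    (hu : ∀ j, (fun i => u (i, j)) ∈ RS α k₁) (hw : ∀ i, (fun j => w (i, j)) ∈ RS β k₂)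
    (herr : weight (u - w) < (s + 1) ^ 2) (hι : 2 * s + k₁ + k₂ < Fintype.card ι)
    (hκ : 2 * s + k₁ + k₂ < Fintype.card κ) :
    ∃ t ∈ tensor (RS α k₁) (RS β k₂), ∃ B : Finset ι, B.card ≤ s ∧
      ∀ i ∉ B, ∀ j, w (i, j) = t (i, j) := by
  classical
  -- The error locator: `(s + 1) ^ 2` coefficients against fewer than `(s + 1) ^ 2` vanishing
  -- conditions.
  obtain ⟨E, hE, hdE, hdE', hzE⟩ : ∃ E : F[X][Y], E ≠ 0 ∧ E.natDegree ≤ s ∧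
      (swap E).natDegree ≤ s ∧
      ∀ i j, u (i, j) ≠ w (i, j) → (E.eval (C (β j))).eval (α i) = 0 := by
    let Ψ : (Fin (s + 1) × Fin (s + 1) → F) →ₗ[F] ({p // (u - w) p ≠ 0} → F) :=
      LinearMap.pi fun p => (leval (α p.1.1)) ∘ₗ ((leval (C (β p.1.2))).restrictScalars F) ∘ₗ
        biPoly (s + 1) (s + 1)
    have hker : LinearMap.ker Ψ ≠ ⊥ := by
      apply LinearMap.ker_ne_bot_of_finrank_lt
      simp only [finrank_fintype_fun_eq_card, Fintype.card_prod, Fintype.card_fin,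
        Fintype.card_subtype]
      rw [← sq]
      exact herr
    obtain ⟨g, hg, hne⟩ := Submodule.exists_mem_ne_zero_of_ne_bot hker
    have hE : biPoly (s + 1) (s + 1) g ≠ 0 :=
      (map_ne_zero_iff _ (biPoly_injective _ _)).2 hne
    refine ⟨_, hE, ?_, ?_, fun i j hij => ?_⟩
    · exact Nat.lt_succ_iff.1 ((natDegree_lt_iff_degree_lt hE).2 (degree_biPoly_lt g))
    · exact Nat.lt_succ_iff.1
        ((natDegree_lt_iff_degree_lt (swap_ne_zero hE)).2 (degree_swap_biPoly_lt g))
    · exact congrFun hg ⟨(i, j), sub_ne_zero.2 hij⟩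
  have hsE := swap_ne_zero hE
  choose c hc huc using fun j => mem_RS.1 (hu j)
  choose r hr hwr using fun i => mem_RS.1 (hw i)
  have hline : ∀ y, (E.eval (C y)).degree ≤ (swap E).natDegree := fun y =>
    (degree_eval_C_le E y).trans degree_le_natDegree
  have hline' : ∀ x, ((swap E).eval (C x)).degree ≤ E.natDegree := fun x =>
    (degree_eval_C_le _ x).trans (by rw [swap_swap_apply]; exact degree_le_natDegree)
  have hcd : ∀ j, (E.eval (C (β j)) * c j).degree < ((swap E).natDegree + k₁ : ℕ) := fun j =>
    degree_mul_lt (hline _) (hc j)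
  have hrd : ∀ i, ((swap E).eval (C (α i)) * r i).degree < (E.natDegree + k₂ : ℕ) := fun i =>
    degree_mul_lt (hline' _) (hr i)
  have hval : ∀ i j, (E.eval (C (β j))).eval (α i) * u (i, j) =
      (E.eval (C (β j))).eval (α i) * w (i, j) := fun i j => by
    by_cases h : u (i, j) = w (i, j)
    · rw [h]
    · rw [hzE i j h, zero_mul, zero_mul]
  -- After multiplication by `E` the two matrices coincide, so the product has low degree along both
  -- rows and columns.
  obtain ⟨P, hP, hP', hPv⟩ := exists_bivariate_of_mem_tensor (α := α) (β := β)
    (c := fun p => (E.eval (C (β p.2))).eval (α p.1) * w p)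
    (k₁ := (swap E).natDegree + k₁) (k₂ := E.natDegree + k₂) ⟨fun j => mem_RS.2
      ⟨_, hcd j, fun i => by rw [eval_mul, ← huc, hval]⟩, fun i => mem_RS.2
      ⟨_, hrd i, fun j => by rw [eval_mul, ← hwr, eval_swap_eval]⟩⟩
  -- Both sides have degree below the number of evaluation points, so equal values give equal
  -- polynomials.
  have hrow : ∀ i, (swap P).eval (C (α i)) = (swap E).eval (C (α i)) * r i := fun i => by
    rw [← sub_eq_zero]
    refine eq_zero_of_eval_eq_zero hβ ?_ fun j => ?_
    · refine (degree_sub_le _ _).trans_lt ((max_lt ?_ (hrd i)).trans_le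
        (Nat.cast_le.2 (by omega : E.natDegree + k₂ ≤ _)))
      exact (degree_eval_C_le _ _).trans_lt (by rwa [swap_swap_apply])
    · rw [eval_sub, eval_mul, eval_swap_eval, eval_swap_eval, ← hPv, ← hwr, sub_self]
  have hcol : ∀ j, P.eval (C (β j)) = E.eval (C (β j)) * c j := fun j => by
    rw [← sub_eq_zero]
    refine eq_zero_of_eval_eq_zero hα ?_ fun i => ?_
    · refine (degree_sub_le _ _).trans_lt ((max_lt ?_ (hcd j)).trans_le
        (Nat.cast_le.2 (by omega : (swap E).natDegree + k₁ ≤ _)))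
      exact (degree_eval_C_le _ _).trans_lt hP'
    · rw [eval_sub, eval_mul, ← hPv, ← huc, hval, sub_self]
  obtain ⟨Q, rfl⟩ : E ∣ P := by
    refine dvd_of_dvd_on_lines (d := k₁) (e := k₂) (s := Finset.univ.image α)
      (t := Finset.univ.image β) hE hP hP' ?_ ?_ ?_ ?_
    · rw [Finset.card_image_of_injective _ hα, Finset.card_univ]; omega
    · rw [Finset.card_image_of_injective _ hβ, Finset.card_univ]; omega
    · intro x hx
      obtain ⟨i, -, rfl⟩ := Finset.mem_image.1 hx
      exact ⟨r i, hr i, hrow i⟩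
    · intro y hy
      obtain ⟨j, -, rfl⟩ := Finset.mem_image.1 hy
      exact ⟨c j, hc j, hcol j⟩
  have hQ := degree_lt_of_mul hE hP
  rw [map_mul] at hP'
  have hQ' := degree_lt_of_mul hsE hP'
  refine ⟨fun p => (Q.eval (C (β p.2))).eval (α p.1), ⟨fun j => mem_RS.2
    ⟨_, (degree_eval_C_le _ _).trans_lt hQ', fun i => rfl⟩, fun i => mem_RS.2
    ⟨(swap Q).eval (C (α i)), (degree_eval_C_le _ _).trans_lt (by rwa [swap_swap_apply]),
      fun j => (eval_swap_eval _ _ _).symm⟩⟩,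
    -- The exceptional rows are those on which `E` vanishes identically; on the others it cancels.
    Finset.univ.filter fun i => (swap E).eval (C (α i)) = 0, ?_, fun i hi j => ?_⟩
  · rw [← Finset.card_image_of_injective _ hα]
    refine (card_le_natDegree_of_eval_C_eq_zero hsE fun x hx => ?_).trans hdE'
    obtain ⟨i, hi, rfl⟩ := Finset.mem_image.1 hx
    exact (Finset.mem_filter.1 hi).2
  · have hi' : (swap E).eval (C (α i)) ≠ 0 := by simpa using hi
    have h := hrow i
    rw [map_mul, eval_mul] at h
    rw [hwr, ← mul_left_cancel₀ hi' h, eval_swap_eval]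

end ReedSolomon

/-! ### Dimensions of evaluation codes. -/

section ReedSolomonDimension

variable {F : Type*} [Field F] {ι κ : Type*} {α : ι → F} {β : κ → F}

theorem RS_mono {k l : ℕ} (h : k ≤ l) : RS α k ≤ RS α l := fun v hv => by
  obtain ⟨f, hf, hv⟩ := mem_RS.1 hv
  exact mem_RS.2 ⟨f, hf.trans_le (Nat.cast_le.2 h), hv⟩

theorem polysOn_Ico (F : Type*) [Field F] (a b : ℕ) :
    polysOn F (Set.Ico a b) = (degreeLT F (b - a)).map (LinearMap.mulLeft F (X ^ a)) := by
  ext f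
  constructor
  · intro hf
    obtain ⟨g, rfl⟩ : X ^ a ∣ f := X_pow_dvd_iff.2 fun d hd => hf d fun h => by
      exact absurd h.1 (not_le.2 hd)
    refine ⟨g, mem_degreeLT.2 ((degree_lt_iff_coeff_zero _ _).2 fun n hn => ?_), rfl⟩
    have := hf (n + a) fun h => by have := h.2; omega
    rwa [coeff_X_pow_mul] at this
  · rintro ⟨g, hg, rfl⟩ n hn
    rw [LinearMap.mulLeft_apply, coeff_X_pow_mul']
    split_ifs with h
    · refine coeff_eq_zero_of_degree_lt ((mem_degreeLT.1 hg).trans_le (Nat.cast_le.2 ?_))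
      by_contra h'
      exact hn ⟨h, by omega⟩
    · rfl

theorem mem_evCode_Ico {a b : ℕ} {v : ι → F} :
    v ∈ evCode α (Set.Ico a b) ↔
      ∃ g : F[X], g.degree < (b - a : ℕ) ∧ ∀ i, v i = α i ^ a * g.eval (α i) := by
  rw [evCode, polysOn_Ico]
  constructor
  · rintro ⟨_, ⟨g, hg, rfl⟩, rfl⟩
    exact ⟨g, mem_degreeLT.1 hg, fun i => by simp [evalAt]⟩
  · rintro ⟨g, hg, h⟩
    exact ⟨_, ⟨g, mem_degreeLT.2 hg, rfl⟩, by ext i; simp [evalAt, h]⟩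

theorem degree_X_pow_mul_lt {a b : ℕ} (h : a ≤ b) {g : F[X]} (hg : g.degree < (b - a : ℕ)) :
    (X ^ a * g).degree < ((b : ℕ) : WithBot ℕ) := by
  have := degree_mul_lt (f := (X ^ a : F[X])) (degree_X_pow_le a) hg
  rwa [Nat.add_sub_cancel' h] at this

theorem finrank_evCode_Ico [Fintype ι] (hα : Function.Injective α) {a b : ℕ}
    (hab : a ≤ b) (hb : b ≤ Fintype.card ι) :
    finrank F (evCode α (Set.Ico a b)) = b - a := by
  let f : degreeLT F (b - a) →ₗ[F] (ι → F) :=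
    evalAt α ∘ₗ LinearMap.mulLeft F (X ^ a) ∘ₗ (degreeLT F (b - a)).subtype
  have hf : Function.Injective f := by
    rw [← LinearMap.ker_eq_bot, LinearMap.ker_eq_bot']
    rintro ⟨g, hg⟩ h
    have := eq_zero_of_eval_eq_zero hα (f := X ^ a * g)
      ((degree_X_pow_mul_lt hab (mem_degreeLT.1 hg)).trans_le (Nat.cast_le.2 hb))
      fun i => congrFun h i
    exact Subtype.ext ((mul_eq_zero.1 this).resolve_left (pow_ne_zero _ X_ne_zero))
  have hr : evCode α (Set.Ico a b) = LinearMap.range f := by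
    rw [evCode, polysOn_Ico]
    ext v
    simp [f]
  rw [hr, LinearMap.finrank_range_of_inj hf, (degreeLTEquiv F (b - a)).finrank_eq, finrank_fin_fun]

theorem finrank_RS [Fintype ι] (hα : Function.Injective α) {k : ℕ} (hk : k ≤ Fintype.card ι) :
    finrank F (RS α k) = k := by
  rw [RS, finrank_evCode_Ico hα (Nat.zero_le k) hk, Nat.sub_zero]

/-- A parameter `k` above the length still gives the full space. Normalizing it to the dimension
turns bounds on dimensions into degree bounds. -/
theorem RS_finrank [Fintype ι] (hα : Function.Injective α) (k : ℕ) :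
    RS α (finrank F (RS α k)) = RS α k := by
  rcases le_total k (Fintype.card ι) with hk | hk
  · rw [finrank_RS hα hk]
  · have h : RS α (Fintype.card ι) = ⊤ := Submodule.eq_top_of_finrank_eq (by
      rw [finrank_RS hα le_rfl, finrank_fintype_fun_eq_card])
    have h' : RS α k = ⊤ := top_le_iff.1 (h ▸ RS_mono hk)
    rw [h', finrank_top, finrank_fintype_fun_eq_card, h]

theorem eq_RS_finrank [Fintype ι] (hα : Function.Injective α) {D : Submodule F (ι → F)}
    (h : ∃ k, D = RS α k) : D = RS α (finrank F D) := by
  obtain ⟨k, rfl⟩ := h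
  rw [RS_finrank hα]

/-- A Reed-Solomon word is determined by its restriction to sufficiently many points. -/
theorem eq_zero_of_mem_RS [Fintype ι] (hα : Function.Injective α) {k : ℕ} {v : ι → F}
    (hv : v ∈ RS α k) {B : Finset ι} (hB : B.card + k ≤ Fintype.card ι)
    (h : ∀ i ∉ B, v i = 0) : v = 0 := by
  classical
  obtain ⟨f, hf, hvf⟩ := mem_RS.1 hv
  have hf0 : f = 0 := by
    refine eq_zero_of_degree_lt_of_eval_index_eq_zero (s := Bᶜ) hα.injOn ?_ fun i hi => ?_
    · refine hf.trans_le (Nat.cast_le.2 ?_)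
      rw [Finset.card_compl]
      omega
    · rw [← hvf, h i (Finset.mem_compl.1 hi)]
  ext i
  rw [hvf, hf0, eval_zero, Pi.zero_apply]

end ReedSolomonDimension

/-! ### Distance of products of quantum Reed-Solomon codes. -/

section Distance

variable {F : Type*} [Field F] {ι κ : Type*} [Fintype ι] [Fintype κ] {α : ι → F} {β : κ → F}

/-- Low-weight words of `(Z₁ ⊗ Z₂) + (X₁ ⊗ X₂)^⊥` lie in `(X₁ ⊗ X₂)^⊥`. -/
theorem mem_dual_tensor_of_weight_lt (hα : Function.Injective α) (hβ : Function.Injective β)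
    {X₁ Z₁ : Submodule F (ι → F)} {X₂ Z₂ : Submodule F (κ → F)} {k₁ k₂ p s : ℕ}
    (hX₁ : dual X₁ = RS α k₁) (hZ₂ : Z₂ = RS β k₂) (hZ₁ : Z₁ = RS α p)
    (h₁ : dual X₁ ≤ Z₁) (h₂ : dual X₂ ≤ Z₂)
    (hι : 2 * s + k₁ + k₂ < Fintype.card ι) (hκ : 2 * s + k₁ + k₂ < Fintype.card κ)
    (hp : s + p ≤ Fintype.card ι) {c : ι × κ → F}
    (hc : c ∈ tensor Z₁ Z₂ ⊔ dual (tensor X₁ X₂)) (hw : weight c < (s + 1) ^ 2) :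
    c ∈ dual (tensor X₁ X₂) := by
  obtain ⟨a, ha, d, hd, rfl⟩ := Submodule.mem_sup.1 hc
  refine Submodule.add_mem _ ?_ hd
  obtain ⟨u, hu, v, hv, rfl⟩ := Submodule.mem_sup.1 (dual_tensor_le _ _ hd)
  have hav : ∀ i, (fun j => (-(a + v)) (i, j)) ∈ Z₂ := fun i =>
    Z₂.neg_mem (Z₂.add_mem (ha.2 i) (h₂ (hv.2 i)))
  obtain ⟨t, ht, B, hB, htB⟩ := exists_mem_tensor_of_agreement hα hβ (u := u) (w := -(a + v))
    (fun j => hX₁ ▸ hu.1 j) (fun i => hZ₂ ▸ hav i)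
    (by rwa [sub_neg_eq_add, add_left_comm]) hι hκ
  rw [← hX₁, ← hZ₂] at ht
  have htd : t ∈ dual (tensor X₁ X₂) :=
    (tensor_mono le_rfl le_top).trans (tensor_dual_left_le X₁ X₂) ht
  -- Off `B` the rows of `a + t` are those of `-v`, already in `dual X₂`. For `y ∈ X₂` the vector of
  -- row products with `y` is therefore a word of `Z₁` supported on `B`, hence zero.
  have hat : a + t ∈ tensor ⊤ (dual X₂) := by
    refine ⟨fun _ => trivial, fun i y hy => ?_⟩
    have hcol : (fun i => ∑ j, (a + t) (i, j) * y j) ∈ Z₁ :=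
      mulVec_mem (fun j => Z₁.add_mem (ha.1 j) (h₁ (ht.1 j))) y
    rw [hZ₁] at hcol
    refine congrFun (eq_zero_of_mem_RS hα hcol (B := B) (by omega) fun i hi => ?_) i
    have hrow : ∀ j, (a + t) (i, j) = - v (i, j) := fun j => by
      have := htB i hi j
      simp only [Pi.neg_apply, Pi.add_apply] at this ⊢
      linear_combination -this
    have := hv.2 i y hy
    rw [dotProduct] at this
    simp only [hrow, neg_mul, Finset.sum_neg_distrib, this, neg_zero]
  have := Submodule.sub_mem _ (tensor_dual_right_le X₁ X₂ hat) htd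
  rwa [add_sub_cancel_right] at this

namespace SubsystemCode

theorem le_distance {Q : SubsystemCode F ι} {d : ℝ}
    (hX : ∀ c ∈ Q.X ⊔ dual Q.Z, (weight c : ℝ) < d → c ∈ dual Q.Z)
    (hZ : ∀ c ∈ Q.Z ⊔ dual Q.X, (weight c : ℝ) < d → c ∈ dual Q.X) :
    ENNReal.ofReal d ≤ (Q.distance : ℝ≥0∞) := by
  have h : (⌈d⌉₊ : ℕ∞) ≤ Q.distance := by
    refine le_iInf₂ fun c hc => Nat.cast_le.2 (Nat.ceil_le.2 (not_lt.1 fun hlt => ?_))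
    rcases hc with ⟨hc, hc'⟩ | ⟨hc, hc'⟩
    · exact hc' (hX c hc hlt)
    · exact hc' (hZ c hc hlt)
  calc ENNReal.ofReal d ≤ ENNReal.ofReal (⌈d⌉₊ : ℝ) := ENNReal.ofReal_le_ofReal (Nat.le_ceil d)
    _ = ((⌈d⌉₊ : ℕ∞) : ℝ≥0∞) := by rw [ENNReal.ofReal_natCast]; rfl
    _ ≤ _ := ENat.toENNReal_mono h

/-- Products of two quantum Reed-Solomon codes of low enough rates have linear distance. -/
theorem prod_hasParams (hα : Function.Injective α) (hβ : Function.Injective β) {n : ℕ}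
    (hι : Fintype.card ι = n) (hκ : Fintype.card κ = n) {ε : ℝ} (hε : 0 < ε)
    {Q₁ : SubsystemCode F ι} {Q₂ : SubsystemCode F κ}
    (h₁ : Q₁.IsQuantumRS α) (h₂ : Q₂.IsQuantumRS β)
    (hX : (finrank F Q₁.X : ℝ) ≤ (1 - ε) * n) (hZ : (finrank F Q₁.Z : ℝ) ≤ (1 - ε) * n)
    (hZX : (finrank F (dual Q₁.Z) : ℝ) + finrank F Q₂.X ≤ (1 - ε) * n)
    (hXZ : (finrank F (dual Q₁.X) : ℝ) + finrank F Q₂.Z ≤ (1 - ε) * n) :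
    (Q₁.prod Q₂).HasParams (n ^ 2) (Q₁.dimension * Q₂.dimension) (ε ^ 2 / 9 * (n : ℝ) ^ 2) := by
  obtain ⟨hc₁, hX₁, hX₁', hZ₁, hZ₁'⟩ := h₁
  obtain ⟨hc₂, hX₂, hX₂', hZ₂, hZ₂'⟩ := h₂
  have hc₁' : dual Q₁.Z ≤ Q₁.X := by
    have := dual_anti hc₁
    rwa [dual_dual] at this
  have hc₂' : dual Q₂.Z ≤ Q₂.X := by
    have := dual_anti hc₂
    rwa [dual_dual] at this
  refine ⟨by rw [Fintype.card_prod, hι, hκ, sq], prod_dimension hc₁ hc₂, ?_⟩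
  -- A third of the slack: `2 * s` still fits in `ε * n` strictly, and `(s + 1) ^ 2` exceeds `ε ^ 2
  -- / 9 * n ^ 2`.
  set s := ⌊ε * n / 3⌋₊ with hs
  have hs₀ : (s : ℝ) ≤ ε * n / 3 := Nat.floor_le (by positivity)
  have hs₁ : ε * n / 3 < s + 1 := Nat.lt_floor_add_one _
  have hweight : ∀ c : ι × κ → F, (weight c : ℝ) < ε ^ 2 / 9 * (n : ℝ) ^ 2 →
      weight c < (s + 1) ^ 2 ∧ 0 < n := fun c hc => by
    constructor
    · have : (weight c : ℝ) < (s + 1) ^ 2 := by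
        refine hc.trans ?_
        have h0 : 0 ≤ ε * n / 3 := by positivity
        nlinarith
      exact_mod_cast this
    · rcases Nat.eq_zero_or_pos n with h0 | h0
      · rw [h0] at hc
        norm_num at hc
        exact absurd hc (not_lt.2 (Nat.cast_nonneg _))
      · exact h0
  have harith : ∀ {k₁ k₂ p : ℕ}, 0 < n → (p : ℝ) ≤ (1 - ε) * n →
      (k₁ : ℝ) + k₂ ≤ (1 - ε) * n → 2 * s + k₁ + k₂ < n ∧ s + p ≤ n := fun {k₁ k₂ p} hn hp hk => by
    have hn' : (0 : ℝ) < n := Nat.cast_pos.2 hn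
    have hεn : 0 < ε * n := by positivity
    constructor
    · have : (2 * s + k₁ + k₂ : ℝ) < n := by linarith
      exact_mod_cast this
    · have : (s + p : ℝ) ≤ n := by linarith
      exact_mod_cast this
  refine le_distance (fun c hc hlt => ?_) fun c hc hlt => ?_
  · obtain ⟨hw, hn⟩ := hweight c hlt
    obtain ⟨ha, hb⟩ := harith hn hX hZX
    exact mem_dual_tensor_of_weight_lt hα hβ (eq_RS_finrank hα hZ₁') (eq_RS_finrank hβ hX₂)
      (eq_RS_finrank hα hX₁) hc₁' hc₂' (hι ▸ ha) (hκ ▸ ha) (hι ▸ hb) hc hw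
  · obtain ⟨hw, hn⟩ := hweight c hlt
    obtain ⟨ha, hb⟩ := harith hn hZ hXZ
    exact mem_dual_tensor_of_weight_lt hα hβ (eq_RS_finrank hα hX₁') (eq_RS_finrank hβ hZ₂)
      (eq_RS_finrank hα hZ₁) hc₁ hc₂ (hι ▸ ha) (hκ ▸ ha) (hι ▸ hb) hc hw

end SubsystemCode

end Distance

theorem degree_le_of_lt_add_one {R : Type*} [Semiring R] {f : R[X]} {m : ℕ}
    (h : f.degree < ((m + 1 : ℕ) : WithBot ℕ)) : f.degree ≤ m := by
  rcases eq_or_ne f 0 with rfl | hf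
  · simp
  · rw [← natDegree_lt_iff_degree_lt hf] at h
    exact degree_le_of_natDegree_le (Nat.lt_succ_iff.1 h)

/-! ### Power sums and weighted evaluations over the whole field. -/

section FullField

variable {F : Type*} [Field F] [Fintype F]

theorem sum_eval_eq_zero {f : F[X]} (hf : f.natDegree < Fintype.card F - 1) :
    ∑ x, f.eval x = 0 := by
  simp_rw [eval_eq_sum_range' hf]
  rw [Finset.sum_comm]
  refine Finset.sum_eq_zero fun i hi => ?_
  rw [← Finset.mul_sum, FiniteField.sum_pow_lt_card_sub_one F i (Finset.mem_range.1 hi), mul_zero]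

/-- Products of words have degree at most `q - 2`, so their values sum to zero; dimensions then
force equality. -/
theorem dual_RS_id {k : ℕ} (hk : k ≤ Fintype.card F) :
    dual (RS (id : F → F) k) = RS id (Fintype.card F - k) := by
  symm
  refine Submodule.eq_of_le_of_finrank_eq (fun v hv w hw => ?_) ?_
  · obtain ⟨f, hf, hv⟩ := mem_RS.1 hv
    obtain ⟨g, hg, hw⟩ := mem_RS.1 hw
    have hvw : v ⬝ᵥ w = ∑ x, (f * g).eval x :=
      Finset.sum_congr rfl fun x _ => by rw [hv, hw, eval_mul]; rfl
    rw [hvw]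
    rcases eq_or_ne f 0 with rfl | hf0
    · simp
    rcases eq_or_ne g 0 with rfl | hg0
    · simp
    rw [← natDegree_lt_iff_degree_lt hf0] at hf
    rw [← natDegree_lt_iff_degree_lt hg0] at hg
    exact sum_eval_eq_zero (natDegree_mul_le.trans_lt (by omega))
  · rw [finrank_dual, finrank_RS Function.injective_id hk,
      finrank_RS Function.injective_id (Nat.sub_le _ _)]

/-- Every linear functional on polynomials of degree less than `q` is a linear combination of
evaluations. -/
theorem exists_weights (ψ : F[X] →ₗ[F] F) :
    ∃ a : F → F, ∀ p : F[X], p.degree < Fintype.card F → ∑ x, a x * p.eval x = ψ p := by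
  classical
  refine ⟨fun x => ψ (Lagrange.interpolate Finset.univ id (Pi.single x 1)), fun p hp => ?_⟩
  have hp' := Lagrange.eq_interpolate (s := Finset.univ) (v := (id : F → F))
    Function.injective_id.injOn hp
  conv_rhs => rw [hp', pi_eq_sum_univ' (fun i => p.eval (id i)), map_sum, map_sum]
  refine Finset.sum_congr rfl fun x _ => ?_
  rw [map_smul, map_smul, smul_eq_mul, mul_comm]
  rfl

/-- The functional discards the part of `p` below degree `N`, evaluates the rest at the points of
`T`, and divides by `t ^ N`, which is legitimate as `0 ∉ T`. -/
theorem exists_weights_shift (T : Finset F) (hT : 0 ∉ T) {N : ℕ} (hN : N ≤ Fintype.card F) :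
    ∃ a : F → F, (∀ p : F[X], p.degree < N → ∑ x, a x * p.eval x = 0) ∧
      ∀ g : F[X], (X ^ N * g).degree < (Fintype.card F : WithBot ℕ) →
        ∑ x, a x * (X ^ N * g).eval x = ∑ t ∈ T, g.eval t := by
  obtain ⟨a, ha⟩ := exists_weights (F := F)
    (∑ t ∈ T, (t ^ N)⁻¹ • (leval t ∘ₗ (LinearMap.id - modByMonicHom (X ^ N))))
  refine ⟨a, fun p hp => ?_, fun g hg => ?_⟩
  · rw [ha p (hp.trans_le (Nat.cast_le.2 hN))]
    have : p %ₘ (X ^ N) = p := (modByMonic_eq_self_iff (monic_X_pow N)).2 (by rwa [degree_X_pow])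
    simp [LinearMap.sum_apply, modByMonicHom, this]
  · rw [ha _ hg]
    have : (X ^ N * g) %ₘ (X ^ N) = 0 :=
      (modByMonic_eq_zero_iff_dvd (monic_X_pow N)).2 (dvd_mul_right _ _)
    rw [LinearMap.sum_apply]
    refine Finset.sum_congr rfl fun t ht => ?_
    have ht0 : t ^ N ≠ 0 := pow_ne_zero _ (ne_of_mem_of_not_mem ht hT)
    simp [modByMonicHom, this, ht0]

/-- Every surviving term of the expansion contains some `V h`, of degree below `e`; the other
factors have degree at most `m`, because `e ≤ m + 1`. -/
theorem degree_prod_add_sub_prod_lt {F η : Type*} [Field F] (s : Finset η) {U V : η → F[X]} {m e : ℕ}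
    (hU : ∀ h, (U h).degree ≤ m) (hV : ∀ h, (V h).degree < e) (he : e ≤ m + 1) :
    (∏ h ∈ s, (U h + V h) - ∏ h ∈ s, U h).degree < ((s.card - 1) * m + e : ℕ) := by
  classical
  induction s using Finset.induction_on with
  | empty => simp
  | insert i s hi ih =>
    rw [Finset.prod_insert hi, Finset.prod_insert hi, Finset.card_insert_of_notMem hi,
      Nat.add_sub_cancel]
    have hUV : ∀ h, (U h + V h).degree ≤ m := fun h =>
      (degree_add_le _ _).trans (max_le (hU h) 
        (degree_le_of_lt_add_one ((hV h).trans_le (Nat.cast_le.2 he))))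
    have hprod : (∏ h ∈ s, (U h + V h)).degree ≤ (s.card * m : ℕ) := by
      refine (degree_prod_le _ _).trans ((Finset.sum_le_sum fun h _ => hUV h).trans ?_)
      simp
    have : (U i + V i) * ∏ h ∈ s, (U h + V h) - U i * ∏ h ∈ s, U h =
        U i * (∏ h ∈ s, (U h + V h) - ∏ h ∈ s, U h) + (∏ h ∈ s, (U h + V h)) * V i := by ring
    rw [this]
    refine (degree_add_le _ _).trans_lt (max_lt ?_ (degree_mul_lt hprod (hV i)))
    -- For empty `s` the truncated `s.card - 1` makes the inductive bound too weak, but the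
    -- difference is zero.
    rcases s.eq_empty_or_nonempty with rfl | hs
    · simp
    · have h := degree_mul_lt (hU i) ih
      obtain ⟨c, hc⟩ : ∃ c, s.card = c + 1 := ⟨s.card - 1, by have := hs.card_pos; omega⟩
      rw [hc] at h ⊢
      rw [Nat.add_sub_cancel] at h
      convert h using 2
      ring

/-- Perturbing words of a Reed-Solomon code by words of a much smaller one does not affect
functionals of their product that vanish on low degrees. -/
theorem sum_prod_add_eq {a : F → F} {N r m e : ℕ}
    (ha : ∀ p : F[X], p.degree < N → ∑ x, a x * p.eval x = 0)
    (he : e ≤ m + 1) (hN : (r - 1) * m + e ≤ N) {u v : Fin r → F → F}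
    (hu : ∀ h, u h ∈ RS id (m + 1)) (hv : ∀ h, v h ∈ RS id e) :
    ∑ x, a x * ∏ h, (u h x + v h x) = ∑ x, a x * ∏ h, u h x := by
  choose U hU hU' using fun h => mem_RS.1 (hu h)
  choose V hV hV' using fun h => mem_RS.1 (hv h)
  have hdeg := degree_prod_add_sub_prod_lt Finset.univ (U := U) (V := V) (m := m) (e := e)
    (fun h => degree_le_of_lt_add_one (hU h)) hV he
  rw [Finset.card_univ, Fintype.card_fin] at hdeg
  rw [← sub_eq_zero, ← Finset.sum_sub_distrib, ← ha _ (hdeg.trans_le (Nat.cast_le.2 hN))]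
  refine Finset.sum_congr rfl fun x _ => ?_
  rw [eval_sub, eval_prod, eval_prod, ← mul_sub]
  simp only [eval_add, hU', hV', id]

theorem sum_prod_eq {a : F → F} {T : Finset F} (hT : 0 ∉ T) {lo hi r : ℕ}
    (ha : ∀ g : F[X], (X ^ (r * lo) * g).degree < (Fintype.card F : WithBot ℕ) →
      ∑ x, a x * (X ^ (r * lo) * g).eval x = ∑ t ∈ T, g.eval t)
    (hlo : lo < hi) (hr : 0 < r) (hq : r * hi ≤ Fintype.card F) {l : Fin r → F → F}
    (hl : ∀ h, l h ∈ evCode id (Set.Ico lo hi)) :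
    ∑ x, a x * ∏ h, l h x = ∑ t ∈ T, ∏ h, ((t ^ lo)⁻¹ * l h t) := by
  choose g hg hlg using fun h => mem_evCode_Ico.1 (hl h)
  have hprod : ∀ x, ∏ h, l h x = (X ^ (r * lo) * ∏ h, g h).eval x := fun x => by
    simp only [hlg, id, Finset.prod_mul_distrib, eval_mul, eval_prod, eval_pow, eval_X]
    simp [pow_mul']
  simp_rw [hprod]
  rw [ha]
  · refine Finset.sum_congr rfl fun t ht => ?_
    have ht0 : t ^ lo ≠ 0 := pow_ne_zero _ (ne_of_mem_of_not_mem ht hT)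
    rw [eval_prod]
    refine Finset.prod_congr rfl fun h _ => ?_
    rw [hlg, id, inv_mul_cancel_left₀ ht0]
  · have h₁ : (∏ h, g h).degree ≤ (r * (hi - lo - 1) : ℕ) := by
      refine (degree_prod_le _ _).trans
        ((Finset.sum_le_sum (g := fun _ => ((hi - lo - 1 : ℕ) : WithBot ℕ)) fun h _ => ?_).trans ?_)
      · have : hi - lo = hi - lo - 1 + 1 := by omega
        have h' := hg h
        rw [this] at h'
        exact degree_le_of_lt_add_one h'
      · simp
    have h₂ : (∏ h, g h).degree < (r * (hi - lo) : ℕ) :=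
      h₁.trans_lt (Nat.cast_lt.2 (Nat.mul_lt_mul_of_pos_left (by omega) hr))
    refine (degree_mul_lt (degree_X_pow_le _) h₂).trans_le (Nat.cast_le.2 ?_)
    rwa [← mul_add, Nat.add_sub_cancel' hlo.le]

theorem eq_zero_of_mem_evCode_Ico {F : Type*} [Field F] {lo hi : ℕ} {T : Finset F} (hT : 0 ∉ T)
    (hc : hi - lo ≤ T.card) {v : F → F} (hv : v ∈ evCode id (Set.Ico lo hi))
    (h : ∀ t ∈ T, v t = 0) : v = 0 := by
  obtain ⟨g, hg, hvg⟩ := mem_evCode_Ico.1 hv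
  have hg0 : g = 0 := by
    refine eq_zero_of_degree_lt_of_eval_finset_eq_zero T (hg.trans_le (Nat.cast_le.2 hc))
      fun t ht => ?_
    have := h t ht
    rw [hvg] at this
    exact (mul_eq_zero.1 this).resolve_left (pow_ne_zero _ (ne_of_mem_of_not_mem ht hT))
  ext x
  rw [hvg, hg0, eval_zero, mul_zero, Pi.zero_apply]

end FullField

/-! ### Encodings and transversal gates. -/

namespace SubsystemCode

section Encoding

variable {F : Type*} [Field F] {ι : Type*} [Fintype ι] {Q : SubsystemCode F ι}

theorem SupportsTransversalCZ.supportsTransversalU {r ℓ : ℕ} (hr : 0 < r)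
    {Enc : (Fin ℓ → F) → (ι → F) ⧸ Q.stab} {a : ι → F}
    (h : SupportsTransversalCZ (fun _ : Fin r => Q) (fun _ => Enc) a) :
    SupportsTransversalU r Q Enc a :=
  ⟨h.1 ⟨0, hr⟩, fun z z' hz => by simpa using h.2 (fun _ => z) (fun _ => z') fun _ => hz⟩

/-- If `l ∈ L` is a stabilizer, it represents the coset of `0`. Feed the gate `l` once and the
preimage of the `t`-th unit vector in the remaining slots, of which there is at least one since `r ≥
2`: reading `l` as a logical word gives `dec l t`, reading it as a stabilizer gives `0`. -/
theorem disjoint_stab {L : Submodule F (ι → F)} {r : ℕ} (hr : 2 ≤ r) {τ : Type*} [Fintype τ]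
    (dec : L ≃ₗ[F] (τ → F)) {a : ι → F}
    (hgate : ∀ (l : Fin r → L) (s : Fin r → ι → F), (∀ h, s h ∈ Q.stab) →
      ∑ j, a j * ∏ h, ((l h : ι → F) j + s h j) = ∑ t, ∏ h, dec (l h) t) :
    ∀ l : L, (l : ι → F) ∈ Q.stab → l = 0 := by
  classical
  intro l hl
  apply dec.injective
  rw [map_zero]
  ext t
  let i₀ : Fin r := ⟨0, by omega⟩
  let i₁ : Fin r := ⟨1, by omega⟩
  have hi : i₁ ≠ i₀ := by simp [i₀, i₁]
  let d : L := dec.symm (Pi.single t 1)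
  have h₁ := hgate (fun h => if h = i₀ then l else d) (fun _ => 0) fun _ => Submodule.zero_mem _
  have h₂ := hgate (fun h => if h = i₀ then 0 else d) (fun h => if h = i₀ then l else 0)
    fun h => by split_ifs; exacts [hl, Submodule.zero_mem _]
  have h₃ : ∑ t', ∏ h, dec ((fun h => if h = i₀ then l else d) h) t' = dec l t := by
    rw [Finset.sum_eq_single t]
    · rw [Finset.prod_eq_single i₀]
      · simp
      · intro h _ hh
        simp [hh, d]
      · simp
    · intro t' _ ht'
      refine Finset.prod_eq_zero (Finset.mem_univ i₁) ?_
      simp [hi, d, ht']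
    · simp
  have h₄ : ∑ t', ∏ h, dec ((fun h => if h = i₀ then 0 else d) h) t' = 0 :=
    Finset.sum_eq_zero fun t' _ => Finset.prod_eq_zero (Finset.mem_univ i₀) (by simp)
  rw [← h₃, ← h₁, Pi.zero_apply, ← h₄, ← h₂]
  refine Finset.sum_congr rfl fun j _ => ?_
  congr 1
  refine Finset.prod_congr rfl fun h _ => ?_
  split_ifs <;> simp

/-- A space of code words on which products of stabilizer cosets evaluate as coordinatewise
products gives an encoding with transversal gates. -/
theorem exists_encoding {L S : Submodule F (ι → F)} (hS : S = Q.stab) (hL : L ≤ Q.Z) {r : ℕ}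
    (hr : 2 ≤ r) {τ : Type*} [Fintype τ] (dec : L ≃ₗ[F] (τ → F)) {a : ι → F}
    (hgate : ∀ (l : Fin r → L) (s : Fin r → ι → F), (∀ h, s h ∈ Q.stab) →
      ∑ j, a j * ∏ h, ((l h : ι → F) j + s h j) = ∑ t, ∏ h, dec (l h) t) :
    ∃ Enc : (Fin (finrank F L) → F) ≃ₗ[F] ↥((L ⊔ S).map Q.stab.mkQ),
      SupportsTransversalCZ (fun _ : Fin r => Q) (fun _ z => (Enc z : (ι → F) ⧸ Q.stab)) a ∧
      SupportsTransversalU r Q (fun z => (Enc z : (ι → F) ⧸ Q.stab)) a := by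
  subst hS
  have hcard : Fintype.card τ = finrank F L := by
    rw [dec.finrank_eq, finrank_fintype_fun_eq_card]
  let e : τ ≃ Fin (finrank F L) := Fintype.equivFinOfCardEq hcard
  let dec' : L ≃ₗ[F] (Fin (finrank F L) → F) := dec ≪≫ₗ LinearEquiv.funCongrLeft F F e.symm
  have hdec' : ∀ l j, dec' l j = dec l (e.symm j) := fun l j => rfl
  let f : L →ₗ[F] ↥((L ⊔ Q.stab).map Q.stab.mkQ) :=
    (Q.stab.mkQ ∘ₗ L.subtype).codRestrict _ fun l =>
      Submodule.mem_map_of_mem (Submodule.mem_sup_left l.2)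
  have hf : Function.Bijective f := by
    constructor
    · rw [← LinearMap.ker_eq_bot, LinearMap.ker_eq_bot']
      intro l hl
      refine disjoint_stab hr dec hgate l ?_
      have h : Q.stab.mkQ (l : ι → F) = 0 := congrArg Subtype.val hl
      rwa [Submodule.mkQ_apply, Submodule.Quotient.mk_eq_zero] at h
    · rintro ⟨_, y, hy, rfl⟩
      obtain ⟨l, hl, s, hs, rfl⟩ := Submodule.mem_sup.1 hy
      refine ⟨⟨l, hl⟩, Subtype.ext ?_⟩
      change Q.stab.mkQ l = Q.stab.mkQ (l + s)
      rw [map_add, Submodule.mkQ_apply _ s, (Submodule.Quotient.mk_eq_zero _).2 hs, add_zero]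
  -- Each logical word is sent to the coset of its unique representative in `L`, so any two
  -- representatives differ by a stabilizer and `hgate` applies.
  let Enc := dec'.symm ≪≫ₗ LinearEquiv.ofBijective f hf
  have hEnc : ∀ z, (Enc z : (ι → F) ⧸ Q.stab) = Q.stab.mkQ (dec'.symm z : ι → F) := fun z => rfl
  have hCZ : SupportsTransversalCZ (fun _ : Fin r => Q)
      (fun _ z => (Enc z : (ι → F) ⧸ Q.stab)) a := by
    refine ⟨fun _ => ⟨Subtype.val_injective.comp Enc.injective, fun z => ?_⟩, fun z z' hz => ?_⟩
    · change (Enc z : (ι → F) ⧸ Q.stab) ∈ _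
      rw [hEnc]
      exact Submodule.mem_map_of_mem (hL (dec'.symm z).2)
    · have hs : ∀ h, z' h - (dec'.symm (z h) : ι → F) ∈ Q.stab := fun h => by
        have : Q.stab.mkQ (z' h) = (Enc (z h) : (ι → F) ⧸ Q.stab) := hz h
        rw [hEnc, ← sub_eq_zero, ← map_sub, Submodule.mkQ_apply,
          Submodule.Quotient.mk_eq_zero] at this
        exact this
      have h := hgate (fun h => dec'.symm (z h)) _ hs
      simp only [Pi.sub_apply, add_sub_cancel] at h
      rw [h, ← e.symm.sum_comp]
      refine Finset.sum_congr rfl fun j _ => Finset.prod_congr rfl fun h _ => ?_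
      rw [← hdec', LinearEquiv.apply_symm_apply]
  exact ⟨Enc, hCZ, hCZ.supportsTransversalU (by omega)⟩

end Encoding

section Gate

variable {F : Type*} [Field F] [Fintype F]

/-- Existence of transversal gates on the product of two CSS codes whose components lie in
Reed-Solomon codes. -/
theorem exists_transversal_gates {Q₁ Q₂ : SubsystemCode F F} (h₁ : Q₁.IsCSS) (h₂ : Q₂.IsCSS)
    {lo m e r : ℕ} (hr : 2 ≤ r) (hlo : lo ≤ m) (hm : r * (m + 1) ≤ Fintype.card F)
    (he : e ≤ m + 1) (hN : (r - 1) * m + e ≤ r * lo)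
    (hX₁ : dual Q₁.X ≤ RS id e) (hX₂ : dual Q₂.X ≤ RS id e) (hZ₂ : Q₂.Z ≤ RS id (m + 1))
    {L₁ : Submodule F (F → F)} (hL : L₁ = evCode id (Set.Ico lo (m + 1)))
    (hL₁ : L₁ ≤ Q₁.Z) (hL₂ : L₁ ≤ Q₂.Z) {S : Submodule F (F × F → F)} (hS : S = (Q₁.prod Q₂).stab) :
    ∃ (Enc : (Fin (finrank F (tensor L₁ L₁)) → F) ≃ₗ[F]
        ↥((tensor L₁ L₁ ⊔ S).map (Q₁.prod Q₂).stab.mkQ)) (a : F × F → F),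
      SupportsTransversalCZ (fun _ : Fin r => Q₁.prod Q₂)
        (fun _ z => (Enc z : (F × F → F) ⧸ (Q₁.prod Q₂).stab)) a ∧
      SupportsTransversalU r (Q₁.prod Q₂)
        (fun z => (Enc z : (F × F → F) ⧸ (Q₁.prod Q₂).stab)) a := by
  classical
  have hmq : m + 1 < Fintype.card F := by nlinarith
  obtain ⟨T, hT', hTcard⟩ : ∃ T ⊆ Finset.univ.erase (0 : F), T.card = m + 1 - lo :=
    Finset.exists_subset_card_eq (by
      rw [Finset.card_erase_of_mem (Finset.mem_univ _), Finset.card_univ]; omega)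
  have hT : (0 : F) ∉ T := fun h => Finset.notMem_erase _ _ (hT' h)
  obtain ⟨w, hw₀, hw₁⟩ := exists_weights_shift T hT (N := r * lo) (by nlinarith)
  -- Logical coordinates are values on `T × T` stripped of the monomial factor of degree `lo` in
  -- each variable. As `T` has as many points as `L₁` has dimensions, this is an isomorphism.
  let f : tensor L₁ L₁ →ₗ[F] (T × T → F) := LinearMap.pi fun p =>
    (((p.1 : F) ^ lo)⁻¹ * ((p.2 : F) ^ lo)⁻¹) •
      (LinearMap.proj ((p.1 : F), (p.2 : F)) ∘ₗ (tensor L₁ L₁).subtype)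
  have hf_apply : ∀ l t t', f l (t, t') = ((t : F) ^ lo)⁻¹ * ((t' : F) ^ lo)⁻¹ *
      (l : F × F → F) ((t : F), (t' : F)) := fun l t t' => rfl
  have hne : ∀ t ∈ T, (t ^ lo)⁻¹ ≠ 0 := fun t ht =>
    inv_ne_zero (pow_ne_zero _ (ne_of_mem_of_not_mem ht hT))
  have hf : Function.Injective f := by
    rw [← LinearMap.ker_eq_bot, LinearMap.ker_eq_bot']
    rintro ⟨l, hl⟩ h
    have hTT : ∀ t ∈ T, ∀ t' ∈ T, l (t, t') = 0 := fun t ht t' ht' => by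
      have := congrFun h (⟨t, ht⟩, ⟨t', ht'⟩)
      rw [hf_apply] at this
      exact (mul_eq_zero.1 this).resolve_left (mul_ne_zero (hne t ht) (hne t' ht'))
    have hcol : ∀ t' ∈ T, ∀ x, l (x, t') = 0 := fun t' ht' => congrFun
      (eq_zero_of_mem_evCode_Ico hT hTcard.ge (hL ▸ hl.1 t') fun t ht => hTT t ht t' ht')
    refine Subtype.ext (funext fun ⟨x, y⟩ => ?_)
    exact congrFun (eq_zero_of_mem_evCode_Ico hT hTcard.ge (hL ▸ hl.2 x)
      fun t' ht' => hcol t' ht' x) y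
  have hrank : finrank F (tensor L₁ L₁) = finrank F (T × T → F) := by
    rw [finrank_tensor, hL, finrank_evCode_Ico Function.injective_id (by omega) hmq.le,
      finrank_fintype_fun_eq_card, Fintype.card_prod, Fintype.card_coe, hTcard]
  let dec := LinearMap.linearEquivOfInjective f hf hrank
  have hdec : ∀ l t t', dec l (t, t') = ((t : F) ^ lo)⁻¹ * ((t' : F) ^ lo)⁻¹ *
      (l : F × F → F) ((t : F), (t' : F)) := fun l t t' => rfl
  have hLRS : L₁ ≤ RS id (m + 1) := hL₂.trans hZ₂
  suffices hgate : ∀ (l : Fin r → tensor L₁ L₁) (s : Fin r → F × F → F),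
      (∀ h, s h ∈ (Q₁.prod Q₂).stab) →
      ∑ p, (w p.1 * w p.2) * ∏ h, ((l h : F × F → F) p + s h p) = ∑ t, ∏ h, dec (l h) t by
    obtain ⟨Enc, hEnc⟩ := exists_encoding hS (tensor_mono hL₁ hL₂) hr dec
      (a := fun p => w p.1 * w p.2) hgate
    exact ⟨Enc, _, hEnc⟩
  intro l s hs
  choose σ hσ τ hτ hs using fun h => Submodule.mem_sup.1 (prod_stab_le h₁ h₂ (hs h))
  -- The order matters. The part `τ` goes first, along rows: the rows of `σ` lie in `Z₂`, whose
  -- degrees are small enough, whereas nothing bounds the degrees in `Z₁`, where the columns of `τ`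
  -- lie.
  have step₁ : ∀ x, ∑ y, w y * ∏ h, ((l h : F × F → F) (x, y) + s h (x, y)) =
      ∑ y, w y * ∏ h, ((l h : F × F → F) (x, y) + σ h (x, y)) := fun x => by
    have := sum_prod_add_eq hw₀ he hN
      (u := fun h y => (l h : F × F → F) (x, y) + σ h (x, y)) (v := fun h y => τ h (x, y))
      (fun h => Submodule.add_mem _ (hLRS ((l h).2.2 x)) (hZ₂ ((hσ h).2 x)))
      (fun h => hX₂ ((hτ h).2 x))
    rw [← this]
    refine Finset.sum_congr rfl fun y _ => ?_
    congr 1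
    refine Finset.prod_congr rfl fun h _ => ?_
    rw [← hs h, Pi.add_apply, add_assoc]
  have step₂ : ∀ y, ∑ x, w x * ∏ h, ((l h : F × F → F) (x, y) + σ h (x, y)) =
      ∑ t ∈ T, ∏ h, ((t ^ lo)⁻¹ * (l h : F × F → F) (t, y)) := fun y => by
    rw [sum_prod_add_eq hw₀ he hN (fun h => hLRS ((l h).2.1 y)) (fun h => hX₁ ((hσ h).1 y))]
    exact sum_prod_eq hT hw₁ (Nat.lt_succ_iff.2 hlo) (by omega) hm (fun h => hL ▸ (l h).2.1 y)
  have step₃ : ∀ t ∈ T, ∑ y, w y * ∏ h, ((t ^ lo)⁻¹ * (l h : F × F → F) (t, y)) =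
      ∑ t' ∈ T, ∏ h, ((t' ^ lo)⁻¹ * ((t ^ lo)⁻¹ * (l h : F × F → F) (t, t'))) := fun t _ =>
    sum_prod_eq hT hw₁ (Nat.lt_succ_iff.2 hlo) (by omega) hm
      (l := fun h y => (t ^ lo)⁻¹ * (l h : F × F → F) (t, y))
      (fun h => Submodule.smul_mem _ _ (hL ▸ (l h).2.2 t))
  calc ∑ p : F × F, (w p.1 * w p.2) * ∏ h, ((l h : F × F → F) p + s h p)
      = ∑ x, w x * ∑ y, w y * ∏ h, ((l h : F × F → F) (x, y) + s h (x, y)) := by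
        simp_rw [Fintype.sum_prod_type, Finset.mul_sum, mul_assoc]
    _ = ∑ y, w y * ∑ x, w x * ∏ h, ((l h : F × F → F) (x, y) + σ h (x, y)) := by
        simp_rw [step₁, Finset.mul_sum]
        rw [Finset.sum_comm]
        exact Finset.sum_congr rfl fun _ _ => Finset.sum_congr rfl fun _ _ => mul_left_comm _ _ _
    _ = ∑ t ∈ T, ∑ y, w y * ∏ h, ((t ^ lo)⁻¹ * (l h : F × F → F) (t, y)) := by
        simp_rw [step₂, Finset.mul_sum]
        rw [Finset.sum_comm]
    _ = ∑ t ∈ T, ∑ t' ∈ T, ∏ h, ((t' ^ lo)⁻¹ * ((t ^ lo)⁻¹ * (l h : F × F → F) (t, t'))) :=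
        Finset.sum_congr rfl step₃
    _ = ∑ t, ∏ h, dec (l h) t := by
        rw [Fintype.sum_prod_type, ← Finset.sum_coe_sort]
        refine Finset.sum_congr rfl fun t _ => ?_
        rw [← Finset.sum_coe_sort]
        refine Finset.sum_congr rfl fun t' _ => Finset.prod_congr rfl fun h _ => ?_
        rw [hdec]
        ring

end Gate

end SubsystemCode

/-! ### Numerical estimates and the concrete codes. -/

/-- The inequalities between the degree bounds of the codes with transversal gates. -/
theorem degree_bounds {r q f hi lo : ℕ} (hr : 2 ≤ r) (hq : 4 * r ^ 2 ≤ q)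
    (hf : f = ⌊(1 / (4 * r) : ℚ) * q⌋₊) (hhi : hi = ⌊(q : ℚ) / r⌋₊)
    (hlo : lo = ⌈(q : ℚ) / r - q / (2 * r ^ 2)⌉₊) :
    4 * r * f ≤ q ∧ q < 4 * r * (f + 1) ∧ r * hi ≤ q ∧ q < r * (hi + 1) ∧ lo < hi ∧
      (r - 1) * (hi - 1) + 2 * f ≤ r * lo := by
  have hr' : (2 : ℚ) ≤ r := by exact_mod_cast hr
  have hq' : (4 * r ^ 2 : ℚ) ≤ q := by exact_mod_cast hq
  have hr₀ : (0 : ℚ) < r := by linarith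
  have hq₀ : (0 : ℚ) ≤ q := Nat.cast_nonneg q
  have f₁ : (4 * r * f : ℚ) ≤ q := by
    have h : (f : ℚ) ≤ 1 / (4 * r) * q := hf ▸ Nat.floor_le (by positivity)
    rw [one_div_mul_eq_div, le_div_iff₀ (by positivity)] at h
    linarith
  have f₂ : (q : ℚ) < 4 * r * (f + 1) := by
    have h : (1 / (4 * r) * q : ℚ) < f + 1 := hf ▸ Nat.lt_floor_add_one _
    rw [one_div_mul_eq_div, div_lt_iff₀ (by positivity)] at h
    linarith
  have g₁ : (r * hi : ℚ) ≤ q := by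
    have h : (hi : ℚ) ≤ q / r := hhi ▸ Nat.floor_le (by positivity)
    rw [le_div_iff₀ hr₀] at h
    linarith
  have g₂ : (q : ℚ) < r * (hi + 1) := by
    have h : (q / r : ℚ) < hi + 1 := hhi ▸ Nat.lt_floor_add_one _
    rw [div_lt_iff₀ hr₀] at h
    linarith
  have hdiv : (q : ℚ) / r - q / (2 * r ^ 2) = (2 * r * q - q) / (2 * r ^ 2) := by
    field_simp
  have l₁ : (2 * r * q - q : ℚ) ≤ 2 * r ^ 2 * lo := by
    have h : ((2 * r * q - q) / (2 * r ^ 2) : ℚ) ≤ lo := by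
      rw [hlo, hdiv]
      exact Nat.le_ceil _
    rw [div_le_iff₀ (by positivity)] at h
    linarith
  have l₂ : (2 * r ^ 2 * lo : ℚ) < 2 * r * q - q + 2 * r ^ 2 := by
    have h : (lo : ℚ) < (2 * r * q - q) / (2 * r ^ 2) + 1 := by
      rw [hlo, hdiv]
      exact Nat.ceil_lt_add_one (div_nonneg (by nlinarith) (by positivity))
    rw [div_add_one (by positivity), lt_div_iff₀ (by positivity)] at h
    linarith
  have hlohi : lo < hi := by
    -- The gap `q / (2 * r ^ 2)` is at least `2`, exactly by `4 * r ^ 2 ≤ q`, and absorbs both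
    -- roundings.
    have h : (2 * r ^ 2 * lo : ℚ) < 2 * r ^ 2 * hi := by nlinarith
    exact_mod_cast lt_of_mul_lt_mul_left h (by positivity)
  refine ⟨by exact_mod_cast f₁, by exact_mod_cast f₂, by exact_mod_cast g₁, by exact_mod_cast g₂,
    hlohi, ?_⟩
  -- After scaling by `2 * r`, the left side is at most `2 * (r - 1) * q + q`, which is the lower
  -- bound `l₁` for the right side.
  have h : ((r - 1 : ℚ) * (hi - 1) + 2 * f) * (2 * r) ≤ r * lo * (2 * r) := by
    have : (r - 1 : ℚ) * (r * hi) ≤ (r - 1) * q :=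
      mul_le_mul_of_nonneg_left g₁ (by linarith)
    nlinarith
  have h' := le_of_mul_le_mul_right h (by positivity)
  rw [← Nat.cast_le (α := ℚ)]
  push_cast [Nat.cast_sub (show 1 ≤ r by omega), Nat.cast_sub (show 1 ≤ hi by omega)]
  exact h'

theorem rate_bounds {r q f hi : ℕ} (hr : 2 ≤ r) (hq : 4 * r ^ 2 ≤ q) (f₁ : 4 * r * f ≤ q)
    (f₂ : q < 4 * r * (f + 1)) (g₁ : r * hi ≤ q) (g₂ : q < r * (hi + 1)) :
    (q : ℝ) - f ≤ (1 - 1 / (8 * r)) * q ∧ (f : ℝ) + hi ≤ (1 - 1 / (8 * r)) * q ∧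
      1 / (8 * r) * (q : ℝ) ^ 2 ≤ ((q : ℝ) - 2 * f) * (hi - 2 * f) ∧
      ((q : ℝ) - 2 * f) * (hi - 2 * f) ≤ (q : ℝ) ^ 2 := by
  have hr' : (2 : ℝ) ≤ r := by exact_mod_cast hr
  have hr₀ : (0 : ℝ) < r := by linarith
  have q₀ : (0 : ℝ) ≤ q := Nat.cast_nonneg q
  have f₀ : (0 : ℝ) ≤ f := Nat.cast_nonneg f
  have hi₀ : (0 : ℝ) ≤ hi := Nat.cast_nonneg hi
  have f₁' : (4 * r * f : ℝ) ≤ q := by exact_mod_cast f₁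
  have f₂' : (q : ℝ) < 4 * r * (f + 1) := by exact_mod_cast f₂
  have g₁' : (r * hi : ℝ) ≤ q := by exact_mod_cast g₁
  have g₂' : (q : ℝ) < r * (hi + 1) := by exact_mod_cast g₂
  have hq' : (4 * r ^ 2 : ℝ) ≤ q := by exact_mod_cast hq
  -- Rounding down may cost half of `q / (4 * r)`, since that quotient is at least `2`.
  have hf : 1 / (8 * r) * (q : ℝ) ≤ f := by
    rw [one_div_mul_eq_div, div_le_iff₀ (by positivity)]
    nlinarith
  have a₁ : 1 / 2 * (q : ℝ) ≤ q - 2 * f := by nlinarith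
  have a₂ : 1 / (4 * r) * (q : ℝ) ≤ hi - 2 * f := by
    rw [one_div_mul_eq_div, div_le_iff₀ (by positivity)]
    nlinarith
  have a₃ : (hi : ℝ) ≤ q := by nlinarith
  refine ⟨by linarith, ?_, ?_, ?_⟩
  · have e : (1 - 1 / (8 * r)) * (q : ℝ) = (8 * r - 1) * q / (8 * r) := by field_simp
    rw [e, le_div_iff₀ (by positivity)]
    nlinarith
  · calc 1 / (8 * r) * (q : ℝ) ^ 2 = (1 / 2 * q) * (1 / (4 * r) * q) := by ring
      _ ≤ _ := mul_le_mul a₁ a₂ (by positivity) ((by positivity : 0 ≤ 1 / 2 * (q : ℝ)).trans a₁)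
  · rw [sq]
    exact mul_le_mul (by linarith) (by linarith)
      ((by positivity : 0 ≤ 1 / (4 * r) * (q : ℝ)).trans a₂) q₀

theorem isQuantumRS_id {F : Type*} [Field F] [Fintype F] {kX kZ : ℕ}
    (hX : kX ≤ Fintype.card F) (hZ : kZ ≤ Fintype.card F) (h : Fintype.card F ≤ kX + kZ) :
    (⟨RS id kX, RS id kZ⟩ : SubsystemCode F F).IsQuantumRS id := by
  refine ⟨?_, ⟨_, rfl⟩, ⟨_, dual_RS_id hX⟩, ⟨_, rfl⟩, ⟨_, dual_RS_id hZ⟩⟩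
  change dual (RS id kX) ≤ RS id kZ
  rw [dual_RS_id hX]
  exact RS_mono (by omega)

theorem dimension_RS_id {F : Type*} [Field F] [Fintype F] {kX kZ : ℕ}
    (hX : kX ≤ Fintype.card F) (hZ : kZ ≤ Fintype.card F) (h : Fintype.card F ≤ kX + kZ) :
    (⟨RS id kX, RS id kZ⟩ : SubsystemCode F F).dimension = kX + kZ - Fintype.card F := by
  rw [SubsystemCode.dimension, sup_eq_left.2 (isQuantumRS_id hX hZ h).1, dual_RS_id hX,
    finrank_RS Function.injective_id hZ, finrank_RS Function.injective_id (Nat.sub_le _ _)]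
  omega

end SubsysRS

end

theorem theorem7p2 :
    -- products of two quantum Reed-Solomon codes
    (∀ ε : ℝ, 0 < ε → ∃ Δ : ℝ, 0 < Δ ∧
      ∀ (F : Type u) [Field F] [Fintype F] (n : ℕ) (E₁ E₂ : Finset F)
        (Q₁ : SubsysRS.SubsystemCode F E₁) (Q₂ : SubsysRS.SubsystemCode F E₂),
        E₁.card = n → E₂.card = n →
        Q₁.IsQuantumRS (fun x : E₁ => (x : F)) → Q₂.IsQuantumRS (fun x : E₂ => (x : F)) →
        (finrank F Q₁.X : ℝ) ≤ (1 - ε) * n →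
        (finrank F Q₁.Z : ℝ) ≤ (1 - ε) * n →
        (finrank F (SubsysRS.dual Q₁.Z) : ℝ) + finrank F Q₂.X ≤ (1 - ε) * n →
        (finrank F (SubsysRS.dual Q₁.X) : ℝ) + finrank F Q₂.Z ≤ (1 - ε) * n →
        (Q₁.prod Q₂).HasParams (n ^ 2) (Q₁.dimension * Q₂.dimension) (Δ * (n : ℝ) ^ 2) ∧
        (Q₁.prod Q₂).HasLocality (2 * n)) ∧
    -- the specific product with transversal gates
    (∀ r : ℕ, 2 ≤ r → ∃ Δ c : ℝ, 0 < Δ ∧ 0 < c ∧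
      ∀ (F : Type u) [Field F] [Fintype F], 4 * r ^ 2 ≤ Fintype.card F →
        ∀ (ε : ℚ) (q k₁X k₁Z k₂X k₂Z ℓlo ℓhi : ℕ) (Q₁ Q₂ : SubsysRS.SubsystemCode F F)
          (Q : SubsysRS.SubsystemCode F (F × F)) (L₁ L₂ : Submodule F (F → F))
          (L S : Submodule F (F × F → F)),
        ε = 1 / (4 * r) →
        q = Fintype.card F →
        k₁X = q - ⌊ε * q⌋₊ →
        k₁Z = q - ⌊ε * q⌋₊ →
        k₂X = q - 2 * ⌊ε * q⌋₊ →
        k₂Z = ⌊(q : ℚ) / r⌋₊ →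
        ℓlo = ⌈(q : ℚ) / r - q / (2 * r ^ 2)⌉₊ →
        ℓhi = k₂Z →
        Q₁ = ⟨SubsysRS.RS id k₁X, SubsysRS.RS id k₁Z⟩ →
        Q₂ = ⟨SubsysRS.RS id k₂X, SubsysRS.RS id k₂Z⟩ →
        Q = Q₁.prod Q₂ →
        L₁ = SubsysRS.evCode id (Set.Ico ℓlo ℓhi) →
        L₂ = SubsysRS.evCode id (Set.Ico ℓlo ℓhi) →
        L = SubsysRS.tensor L₁ L₂ →
        S = Q.stab →
        Q₁.IsCSS ∧ Q₂.IsCSS ∧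
        Q.HasParams (q ^ 2) ((k₁X + k₁Z - q) * (k₂X + k₂Z - q)) (Δ * (q : ℝ) ^ 2) ∧
        c * (q : ℝ) ^ 2 ≤ (Q.dimension : ℝ) ∧ (Q.dimension : ℝ) ≤ (q : ℝ) ^ 2 ∧
        Q.HasLocality (2 * q) ∧
        ℓlo < ℓhi ∧ L₁ ≤ Q₁.Z ∧ L₂ ≤ Q₂.Z ∧
        finrank F L = (ℓhi - ℓlo) ^ 2 ∧
        ∃ (Enc : (Fin (finrank F L) → F) ≃ₗ[F] ↥((L ⊔ S).map Q.stab.mkQ)) (a : F × F → F),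
          SubsysRS.SubsystemCode.SupportsTransversalCZ
            (fun _ : Fin r => Q) (fun _ z => (Enc z : (F × F → F) ⧸ Q.stab)) a ∧
          SubsysRS.SubsystemCode.SupportsTransversalU r Q
            (fun z => (Enc z : (F × F → F) ⧸ Q.stab)) a) := by

  open SubsysRS SubsysRS.SubsystemCode in
  refine ⟨fun ε hε => ⟨ε ^ 2 / 9, by positivity, ?_⟩, fun r hr => ?_⟩
  · intro F _ _ n E₁ E₂ Q₁ Q₂ hE₁ hE₂ h₁ h₂ hX hZ hZX hXZ
    have hc₁ : Fintype.card E₁ = n := by rw [Fintype.card_coe, hE₁]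
    have hc₂ : Fintype.card E₂ = n := by rw [Fintype.card_coe, hE₂]
    refine ⟨prod_hasParams Subtype.val_injective Subtype.val_injective hc₁ hc₂ hε h₁ h₂ hX hZ hZX
      hXZ, ?_⟩
    have := prod_hasLocality Q₁ Q₂
    rwa [hc₁, hc₂, ← two_mul] at this
  have hr₀ : (0 : ℝ) < r := Nat.cast_pos.2 (by omega)
  -- The distance bound is applied with slack `1 / (8 * r)`, not `1 / (4 * r)`, to survive the floor
  -- in `f`.
  refine ⟨(1 / (8 * r)) ^ 2 / 9, 1 / (8 * r), by positivity, by positivity, ?_⟩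
  intro F _ _ hcard ε q k₁X k₁Z k₂X k₂Z lo hi Q₁ Q₂ Q L₁ L₂ L S hε hq hk₁X hk₁Z hk₂X hk₂Z hlo hhi
    hQ₁ hQ₂ hQ hL₁ hL₂ hL hS
  obtain ⟨f, hf⟩ : ∃ f, f = ⌊ε * q⌋₊ := ⟨_, rfl⟩
  rw [← hf] at hk₁X hk₁Z hk₂X
  obtain ⟨f₁, f₂, g₁, g₂, hlohi, hN⟩ :=
    degree_bounds hr (hq ▸ hcard) (hε ▸ hf) (hhi.trans hk₂Z) hlo
  rw [← hhi] at hQ₂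
  rw [← hq] at hcard
  have h2f : 2 * f ≤ hi := by
    have : r * (2 * (2 * f)) < r * (hi + 1) := by linarith
    have := lt_of_mul_lt_mul_left this (Nat.zero_le _)
    omega
  have hiq : 2 * hi ≤ q := (Nat.mul_le_mul_right hi hr).trans g₁
  have hk₁X' : k₁X ≤ Fintype.card F := by omega
  have hk₁Z' : k₁Z ≤ Fintype.card F := by omega
  have hk₂X' : k₂X ≤ Fintype.card F := by omega
  have hhi' : hi ≤ Fintype.card F := by omega
  have hs₁ : Fintype.card F ≤ k₁X + k₁Z := by omega
  have hs₂ : Fintype.card F ≤ k₂X + hi := by omega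
  have hd₁ : Fintype.card F - k₁X = f := by omega
  have hd₁' : Fintype.card F - k₁Z = f := by omega
  have hd₂ : Fintype.card F - k₂X = 2 * f := by omega
  have hRS₁ : Q₁.IsQuantumRS id := hQ₁ ▸ isQuantumRS_id hk₁X' hk₁Z' hs₁
  have hRS₂ : Q₂.IsQuantumRS id := hQ₂ ▸ isQuantumRS_id hk₂X' hhi' hs₂
  have hdim₁ : Q₁.dimension = k₁X + k₁Z - q := by rw [hQ₁, dimension_RS_id hk₁X' hk₁Z' hs₁, hq]
  have hdim₂ : Q₂.dimension = k₂X + k₂Z - q := by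
    rw [hQ₂, dimension_RS_id hk₂X' hhi' hs₂, hq, hhi]
  have hdim : Q.dimension = (k₁X + k₁Z - q) * (k₂X + k₂Z - q) := by
    rw [hQ, prod_dimension hRS₁.1 hRS₂.1, hdim₁, hdim₂]
  have hm : hi - 1 + 1 = hi := by omega
  have hZ₁ : Q₁.Z = RS id k₁Z := by rw [hQ₁]
  have hZ₂ : Q₂.Z = RS id hi := by rw [hQ₂]
  have hdX₁ : dual Q₁.X = RS id f := by rw [hQ₁]; exact (dual_RS_id hk₁X').trans (by rw [hd₁])
  have hdX₂ : dual Q₂.X = RS id (2 * f) := by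
    rw [hQ₂]; exact (dual_RS_id hk₂X').trans (by rw [hd₂])
  have hdZ₁ : dual Q₁.Z = RS id f := by rw [hQ₁]; exact (dual_RS_id hk₁Z').trans (by rw [hd₁'])
  have hLRS : evCode (id : F → F) (Set.Ico lo hi) ≤ RS id hi := fun v hv => by
    obtain ⟨g, hg, hv⟩ := mem_evCode_Ico.1 hv
    exact mem_RS.2 ⟨_, degree_X_pow_mul_lt hlohi.le hg, fun i => by simp [hv]⟩
  have hL₁Z : L₁ ≤ Q₁.Z := by
    rw [hL₁, hZ₁]
    exact hLRS.trans (RS_mono (by omega))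
  have hL₂Z : L₂ ≤ Q₂.Z := by
    rw [hL₂, hZ₂]
    exact hLRS
  have hinj : Function.Injective (id : F → F) := Function.injective_id
  obtain ⟨b₁, b₂, b₃, b₄⟩ := rate_bounds hr hcard f₁ f₂ g₁ g₂
  have e₁ : (k₁X : ℝ) = q - f := by rw [hk₁X, Nat.cast_sub (by omega)]
  have e₂ : (k₁Z : ℝ) = q - f := by rw [hk₁Z, Nat.cast_sub (by omega)]
  have e₃ : (f : ℝ) + k₂X = q - f := by rw [hk₂X, Nat.cast_sub (by omega)]; push_cast; ring
  have hparams := prod_hasParams hinj hinj hq.symm hq.symm (ε := 1 / (8 * r)) (by positivity)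
    hRS₁ hRS₂ (by rw [hQ₁, finrank_RS hinj hk₁X']; exact e₁.trans_le b₁)
    (by rw [hZ₁, finrank_RS hinj hk₁Z']; exact e₂.trans_le b₁)
    (by rw [hdZ₁, hQ₂, finrank_RS hinj (by omega), finrank_RS hinj hk₂X']; exact e₃.trans_le b₁)
    (by rw [hdX₁, hZ₂, finrank_RS hinj (by omega), finrank_RS hinj hhi']; exact b₂)
  rw [hdim₁, hdim₂, ← hQ] at hparams
  have hdim' : (Q.dimension : ℝ) = ((q : ℝ) - 2 * f) * (hi - 2 * f) := by
    rw [hdim, show k₁X + k₁Z - q = q - 2 * f by omega, show k₂X + k₂Z - q = hi - 2 * f by omega,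
      Nat.cast_mul, Nat.cast_sub (by omega), Nat.cast_sub h2f]
    push_cast
    rfl
  refine ⟨hRS₁.1, hRS₂.1, hparams, ?_, ?_, ?_, hlohi, hL₁Z, hL₂Z, ?_, ?_⟩
  · rwa [hdim']
  · rwa [hdim']
  · have := prod_hasLocality Q₁ Q₂
    rwa [← hq, ← two_mul, ← hQ] at this
  · rw [hL, finrank_tensor, hL₁, hL₂, finrank_evCode_Ico hinj hlohi.le hhi', sq]
  · obtain rfl : L₂ = L₁ := hL₂.trans hL₁.symm
    subst hL hQ
    -- `hi - 1` is the top degree allowed in `L₁` and in `Q₂.Z`; `2 * f` covers both duals, of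
    -- dimensions `f` and `2 * f`.
    refine exists_transversal_gates hRS₁.1 hRS₂.1 (lo := lo) (m := hi - 1) (e := 2 * f) hr
      (by omega) ?_ (by omega) hN ?_ hdX₂.le ?_ ?_ hL₁Z hL₂Z hS
    · rw [hm, ← hq]; exact g₁
    · rw [hdX₁]; exact RS_mono (by omega)
    · rw [hm]; exact hZ₂.le
    · rw [hm]; exact hL₁
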